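/- Let $d\in\mathbb N$ (for instance $d=2,3$) and let $\Omega\subset\mathbb R^d$ be a bounded open set whose boundary is locally the graph of a continuous function with $\Omega$ on one side: for every $x_0\in\partial\Omega$ there are a unit vector $e$, a continuous $g:\mathbb R^d\to\mathbb R$ and $r>0$ such that, for $|x-x_0|<r$, one has $x\in\Omega$ if and only if $e\cdot x>g(x-(e\cdot x)e)$. (Every bounded Lipschitz domain, and every bounded domain whose boundary is locally a piecewise smooth graph with $\Omega$ on one side, is of this kind.) Let $1<p<\infty$ and let $j:\mathbb R^d\to\mathbb R$ be convex and differentiable with $$\omega_1|r|^p+C_1\le j(r)\le\omega_2|r|^p+C_2\qquad\forall r\in\mathbb R^d,$$ for some $\omega_1,\omega_2>0$ and $C_1,C_2\in\mathbb R$. Put $\beta=\nabla j$. Gradient and divergence of functions on $\Omega$ are taken in the sense of distributions, and $W^{1,p}(\Omega)=\{u\in L^p(\Omega):\nabla u\in L^p(\Omega)^d\}$. In the Hilbert space $H=L^2(\Omega)$ consider the operator $Au=-\operatorname{div}\beta(\nabla u)$ with domain $$D(A)=\{u\in L^2(\Omega)\cap W^{1,p}(\Omega):\ \operatorname{div}\beta(\nabla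 u)\in L^2(\Omega),\ \beta(\nabla u)\cdot\nu=0\text{ on }\partial\Omega\},$$ where the boundary condition is understood in the weak sense $$\int_\Omega\beta(\nabla u)\cdot\nabla\psi\,dx=-\int_\Omega \operatorname{div}\beta(\nabla u)\,\psi\,dx\qquad\forall\psi\in C^1(\overline\Omega),$$ $C^1(\overline\Omega)$ being the space of $\psi\in C^1(\Omega)$ such that $\psi$ and $\nabla\psi$ extend continuously to $\overline\Omega$. Let $\varphi:L^2(\Omega)\to\,]-\infty,+\infty]$, $$\varphi(u)=\begin{cases}\displaystyle\int_\Omega j(\nabla u)\,dx&\text{if }u\in W^{1,p}(\Omega)\text{ and }j(\nabla u)\in L^1(\Omega),\\ +\infty&\text{otherwise.}\end{cases}$$ **Theorem 3.1.** The operator $A$ is maximal monotone in $L^2(\Omega)$, that is, $\langle Au-Av,u-v\rangle\ge0$ for all $u,v\in D(A)$, and for every $f\in L^2(\Omega)$ there is $u\in D(A)$ with $u+Au=f$. More precisely, $\varphi$ is convex and lower semicontinuous on $L^2(\Omega)$, and $A=\partial\varphi$, where $$\partial\varphi(u)=\{y\in L^2(\Omega):\ \varphi(u)\le\varphi(v)+\langle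 y,u-v\rangle\ \ \forall v\in L^2(\Omega)\}$$ (so $\partial\varphi(u)=\{Au\}$ for $u\in D(A)$ and $\partial\varphi(u)=\emptyset$ for $u\notin D(A)$). -/

import Mathlib

open MeasureTheory Set
open scoped ENNReal ContDiff

noncomputable section

namespace ImageRestoring

/-! ### Domains and test functions in `ℝ^d` -/

/-- `ℝ^d` with its Euclidean norm. -/
abbrev Rd (d : ℕ) : Type := EuclideanSpace ℝ (Fin d)

/-- Near each of its boundary points, `Ω` is the part lying strictly above the graph of a
continuous function, the height being measured along some unit vector `e` and the graph being
parametrized by the component orthogonal to `e`. Lipschitz domains, and domains with piecewise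
smooth boundary that are locally on one side of it, are of this kind. -/
def HasContinuousBoundary {d : ℕ} (Ω : Set (Rd d)) : Prop :=
  ∀ x₀ ∈ frontier Ω, ∃ (e : Rd d) (g : Rd d → ℝ) (r : ℝ),
    ‖e‖ = 1 ∧ Continuous g ∧ 0 < r ∧
      ∀ x ∈ Metric.ball x₀ r, (x ∈ Ω ↔ g (x - inner ℝ e x • e) < inner ℝ e x)

/-- `ψ ∈ C_c^∞(Ω)`. -/
def IsTestFunction {d : ℕ} (Ω : Set (Rd d)) (ψ : Rd d → ℝ) : Prop :=
  ContDiff ℝ ∞ ψ ∧ HasCompactSupport ψ ∧ tsupport ψ ⊆ Ω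

/-- `ψ ∈ C¹(Ω̄)`: `ψ` is continuous on the closure of `Ω`, differentiable in `Ω`, and its
gradient has a continuous extension to the closure. -/
def IsC1UpToBoundary {d : ℕ} (Ω : Set (Rd d)) (ψ : Rd d → ℝ) : Prop :=
  ContinuousOn ψ (closure Ω) ∧
    ∃ D : Rd d → Rd d, ContinuousOn D (closure Ω) ∧ ∀ x ∈ Ω, HasGradientAt ψ (D x) x

/-! ### Distributional gradient and divergence, Sobolev space -/

/-- `G = (∂u/∂x₁, …, ∂u/∂x_d)` in the sense of distributions on `Ω`. -/
def HasWeakGradient {d : ℕ} (Ω : Set (Rd d)) (u : Rd d → ℝ) (G : Rd d → Rd d) : Prop :=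
  LocallyIntegrableOn u Ω ∧ LocallyIntegrableOn G Ω ∧
    ∀ ψ : Rd d → ℝ, IsTestFunction Ω ψ → ∀ i : Fin d,
      ∫ x in Ω, u x * (gradient ψ x) i = - ∫ x in Ω, (G x) i * ψ x

/-- `f = div F` in the sense of distributions on `Ω`. -/
def HasWeakDivergence {d : ℕ} (Ω : Set (Rd d)) (F : Rd d → Rd d) (f : Rd d → ℝ) : Prop :=
  LocallyIntegrableOn F Ω ∧ LocallyIntegrableOn f Ω ∧
    ∀ ψ : Rd d → ℝ, IsTestFunction Ω ψ →
      ∫ x in Ω, inner ℝ (F x) (gradient ψ x) = - ∫ x in Ω, f x * ψ x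

/-- `u ∈ W^{1,p}(Ω)`. -/
def MemW1p {d : ℕ} (Ω : Set (Rd d)) (p : ℝ) (u : Rd d → ℝ) : Prop :=
  MemLp u (ENNReal.ofReal p) (volume.restrict Ω) ∧
    ∃ G : Rd d → Rd d, HasWeakGradient Ω u G ∧
      MemLp G (ENNReal.ofReal p) (volume.restrict Ω)

open Classical in
/-- The distributional gradient `∇u` on `Ω` (unique almost everywhere in `Ω` when it exists as a
locally integrable function; `0` when it does not). -/
def weakGradient {d : ℕ} (Ω : Set (Rd d)) (u : Rd d → ℝ) : Rd d → Rd d :=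
  if h : ∃ G : Rd d → Rd d, HasWeakGradient Ω u G then h.choose else 0

/-! ### Multivalued operators in a real Hilbert space -/

section Hilbert

variable {H : Type*} [NormedAddCommGroup H] [InnerProductSpace ℝ H]

/-- A multivalued operator `A : H → 2^H` is monotone. -/
def IsMonotoneOperator (A : H → Set H) : Prop :=
  ∀ x₁ x₂ : H, ∀ y₁ ∈ A x₁, ∀ y₂ ∈ A x₂, 0 ≤ inner ℝ (y₁ - y₂) (x₁ - x₂)

/-- `A` is maximal monotone: it is monotone and `R(I + A) = H`. -/
def IsMaximalMonotone (A : H → Set H) : Prop :=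
  IsMonotoneOperator A ∧ ∀ f : H, ∃ x : H, ∃ y ∈ A x, x + y = f

/-- Convexity of a function with values in `]-∞, +∞]`. -/
def IsConvexFunctional (φ : H → EReal) : Prop :=
  ∀ x y : H, ∀ t : ℝ, 0 < t → t < 1 →
    φ (t • x + (1 - t) • y) ≤ (t : EReal) * φ x + ((1 - t : ℝ) : EReal) * φ y

/-- The subdifferential `∂φ`. -/
def subdifferential (φ : H → EReal) (x : H) : Set H :=
  {y | ∀ u : H, φ x ≤ φ u + ((inner ℝ y (x - u) : ℝ) : EReal)}

end Hilbert

/-! ### The operator and the functional -/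

/-- `L²(Ω)`. -/
abbrev L2 {d : ℕ} (Ω : Set (Rd d)) : Type := Lp ℝ 2 (volume.restrict Ω)

/-- The weak form of `F · ν = 0` on `∂Ω`, where `f = div F`. -/
def WeakNeumann {d : ℕ} (Ω : Set (Rd d)) (F : Rd d → Rd d) (f : Rd d → ℝ) : Prop :=
  ∀ ψ : Rd d → ℝ, IsC1UpToBoundary Ω ψ →
    ∫ x in Ω, inner ℝ (F x) (gradient ψ x) = - ∫ x in Ω, f x * ψ x

/-- The operator `Au = -div β(∇u)`, with domain
`{u ∈ W^{1,p}(Ω) : div β(∇u) ∈ L²(Ω), β(∇u) · ν = 0 on ∂Ω}`. The set `A u` is empty for `u`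
outside the domain. -/
def divOperator {d : ℕ} (Ω : Set (Rd d)) (p : ℝ) (β : Rd d → Rd d) (u : L2 Ω) : Set (L2 Ω) :=
  {w | MemW1p Ω p u ∧ ∃ f : L2 Ω,
    HasWeakDivergence Ω (fun x => β (weakGradient Ω u x)) f ∧
    WeakNeumann Ω (fun x => β (weakGradient Ω u x)) f ∧ w = -f}

open Classical in
/-- `φ(u) = ∫_Ω j(∇u) dx` if `u ∈ W^{1,p}(Ω)` and `j(∇u) ∈ L¹(Ω)`, and `+∞` otherwise. -/
def energy {d : ℕ} (Ω : Set (Rd d)) (p : ℝ) (j : Rd d → ℝ) (u : L2 Ω) : EReal :=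
  if MemW1p Ω p u ∧ Integrable (fun x => j (weakGradient Ω u x)) (volume.restrict Ω) then
    ((∫ x in Ω, j (weakGradient Ω u x) : ℝ) : EReal)
  else ⊤

end ImageRestoring

end

/-! A subdifferential of a proper function is monotone. If the function is also convex, lower
semicontinuous and bounded below, then `x + ∂φ(x) ∋ f` is solved by minimizing `φ + ‖· - f‖² / 2`.
Maximal monotonicity of `A` thus follows from two facts about the energy: it is convex and lower
semicontinuous, and `A = ∂φ`.

Lower semicontinuity (`isClosed_energy_le`) needs no weak topology. The gradients of functions of
energy at most `c` that lie close to `u` form a decreasing sequence of midpoint-convex sets. Almost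
minimizing the strictly convex integral of `√(1 + ‖·‖²)` over these sets yields gradients that
converge almost everywhere (`exists_tendsto_ae_of_midpoint_convex`). The `L^p` bound with `p > 1`
upgrades this to `L¹` convergence, so the limit is `∇u`, and Fatou's lemma bounds the energy of `u`.
The energy also asks for `u ∈ L^p`, while a limit in `L²` only gives `∇u ∈ L^p` when `p > 2`.
`HasWeakGradient.memLp` closes this gap: near the boundary it compares `u` with a translate whose
values are taken in a compact part of `Ω`.

The inclusion `∂φ ⊆ A` is the Euler equation: differentiate `φ` at `u` in the directions `±ψ`, under
the integral sign. The bound `‖β(r)‖ ≤ K (1 + ‖r‖)^(p-1)`, forced by convexity and the growth of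
`j`, places `β(∇u)` in the dual exponent.

The inclusion `A ⊆ ∂φ` integrates the gradient inequality for `j`, which requires the Neumann
identity with the test function `v - u`. This is only in `L² ∩ W^{1,p}`, so the identity is extended
from `C¹(Ω̄)` by density (`WeakNeumann.integral_inner_eq`): localize by cutoffs, then mollify with
kernels whose centre is shifted so that they sample only points of `Ω`. A continuous boundary graph
suffices for such a shift. -/

namespace ImageRestoring
open Filter Topology
-- Subdifferentials and the resolvent equation in a Hilbert space
section Hilbert

variable {H : Type*} [NormedAddCommGroup H] [InnerProductSpace ℝ H]

theorem isMonotoneOperator_subdifferential {φ : H → EReal} (hbot : ∀ x, φ x ≠ ⊥)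
    {x₀ : H} (hx₀ : φ x₀ ≠ ⊤) : IsMonotoneOperator (subdifferential φ) := by
  intro x₁ x₂ y₁ hy₁ y₂ hy₂
  -- The subgradient inequality tested at `x₀`, where `φ` is finite, excludes the value `⊤`;
  -- afterwards everything is real arithmetic.
  have fin : ∀ x y, y ∈ subdifferential φ x → φ x ≠ ⊤ := by
    intro x y hy h
    have h1 := hy x₀
    rw [h, top_le_iff] at h1
    lift φ x₀ to ℝ using ⟨hx₀, hbot x₀⟩ with a
    exact EReal.coe_ne_top _ h1
  have h1 := hy₁ x₂
  have h2 := hy₂ x₁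
  have f1 := fin _ _ hy₁
  have f2 := fin _ _ hy₂
  have b1 := hbot x₁
  have b2 := hbot x₂
  lift φ x₁ to ℝ using ⟨f1, b1⟩ with a
  lift φ x₂ to ℝ using ⟨f2, b2⟩ with b
  norm_cast at h1 h2
  have e : x₂ - x₁ = -(x₁ - x₂) := by abel
  rw [e, inner_neg_right] at h2
  rw [inner_sub_left]
  linarith

/-- A point minimizing `φ + ‖· - f‖² / 2` solves `f - x ∈ ∂φ(x)`. -/
theorem sub_mem_subdifferential_of_forall_le {φ : H → EReal} (hc : IsConvexFunctional φ)
    (hbot : ∀ x, φ x ≠ ⊥) {f x : H} {a : ℝ} (hx : φ x = a)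
    (hmin : ∀ u (b : ℝ), φ u = b → a + ‖x - f‖ ^ 2 / 2 ≤ b + ‖u - f‖ ^ 2 / 2) :
    f - x ∈ subdifferential φ x := by
  intro u
  by_cases hu : φ u = ⊤
  · rw [hu]; simp
  obtain ⟨b, hb⟩ : ∃ b : ℝ, φ u = b := by
    have := hbot u
    lift φ u to ℝ using ⟨hu, this⟩ with b
    exact ⟨b, rfl⟩
  rw [hx, hb]
  norm_cast
  -- Compare `x` with `t u + (1 - t) x`, use convexity and divide by `t`; the quadratic remainder
  -- vanishes as `t → 0`.
  have key : ∀ t : ℝ, 0 < t → t < 1 → a ≤ b + inner ℝ (f - x) (x - u) + t * ‖u - x‖ ^ 2 / 2 := by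
    intro t ht ht1
    have h := hc u x t ht ht1
    rw [hx, hb] at h
    norm_cast at h
    obtain ⟨r, hr⟩ : ∃ r : ℝ, φ (t • u + (1 - t) • x) = r := by
      have h1 := hbot (t • u + (1 - t) • x)
      have h2 : φ (t • u + (1 - t) • x) ≠ ⊤ := ne_top_of_le_ne_top (EReal.coe_ne_top _) h
      lift φ (t • u + (1 - t) • x) to ℝ using ⟨h2, h1⟩ with r
      exact ⟨r, rfl⟩
    rw [hr] at h
    norm_cast at h
    have h3 := hmin _ r hr
    have e : t • u + (1 - t) • x - f = (x - f) + t • (u - x) := by module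
    rw [e, norm_add_sq_real, inner_smul_right, norm_smul, mul_pow, Real.norm_eq_abs, sq_abs] at h3
    have e2 : inner ℝ (f - x) (x - u) = inner ℝ (x - f) (u - x) := by
      rw [← neg_sub x f, ← neg_sub u x, inner_neg_neg]
    rw [e2]
    have : t * a ≤ t * (b + inner ℝ (x - f) (u - x) + t * ‖u - x‖ ^ 2 / 2) := by nlinarith
    exact le_of_mul_le_mul_left this ht
  have hlim : Tendsto (fun t : ℝ => b + inner ℝ (f - x) (x - u) + t * ‖u - x‖ ^ 2 / 2) (𝓝[>] 0)
      (𝓝 (b + inner ℝ (f - x) (x - u) + 0 * ‖u - x‖ ^ 2 / 2)) := by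
    apply Tendsto.mono_left _ nhdsWithin_le_nhds
    apply Continuous.tendsto
    fun_prop
  have := ge_of_tendsto hlim (by
    filter_upwards [Ioo_mem_nhdsGT (zero_lt_one (α := ℝ))] with t ht using key t ht.1 ht.2)
  simpa using this

/-- The functional `φ + ‖· - f‖² / 2` is bounded below. By the parallelogram law and convexity of
`φ` its minimizing sequences are Cauchy, and lower semicontinuity makes the limit a minimizer. -/
theorem exists_add_eq_of_convex_of_lowerSemicontinuous [CompleteSpace H] {φ : H → EReal}
    (hc : IsConvexFunctional φ) (hl : LowerSemicontinuous φ) {c : ℝ} (hb : ∀ x, (c : EReal) ≤ φ x)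
    {x₀ : H} (hx₀ : φ x₀ ≠ ⊤) (f : H) : ∃ x, ∃ y ∈ subdifferential φ x, x + y = f := by
  have hbot : ∀ x, φ x ≠ ⊥ := fun x h => by
    have := hb x
    rw [h, le_bot_iff] at this
    exact EReal.coe_ne_bot _ this
  have hreal : ∀ x, φ x ≠ ⊤ → ∃ a : ℝ, φ x = a := by
    intro x hx
    have := hbot x
    lift φ x to ℝ using ⟨hx, this⟩ with a
    exact ⟨a, rfl⟩
  set S : Set ℝ := {s | ∃ (x : H) (a : ℝ), φ x = a ∧ s = a + ‖x - f‖ ^ 2 / 2} with hS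
  have hSb : BddBelow S := by
    refine ⟨c, ?_⟩
    rintro s ⟨x, a, ha, rfl⟩
    have := hb x
    rw [ha] at this
    norm_cast at this
    nlinarith [sq_nonneg ‖x - f‖]
  have hSn : S.Nonempty := by
    obtain ⟨a, ha⟩ := hreal x₀ hx₀
    exact ⟨_, x₀, a, ha, rfl⟩
  have hex : ∀ n : ℕ, ∃ x : H, ∃ a : ℝ, φ x = a ∧ a + ‖x - f‖ ^ 2 / 2 < sInf S + 1 / ((n : ℝ) + 1) := by
    intro n
    obtain ⟨s, ⟨x, a, ha, rfl⟩, hs⟩ := exists_lt_of_csInf_lt hSn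
      (lt_add_of_pos_right (sInf S) (Nat.one_div_pos_of_nat (n := n)))
    exact ⟨x, a, ha, hs⟩
  choose x a hxa hlt using hex
  -- The midpoint of `x m` and `x n` cannot fall below the infimum, so the parallelogram defect is
  -- bounded by the two excesses.
  have hmid : ∀ m n, ‖x m - x n‖ ^ 2 ≤ 4 * (1 / ((m : ℝ) + 1) + 1 / ((n : ℝ) + 1)) := by
    intro m n
    have h := hc (x m) (x n) (1 / 2) (by norm_num) (by norm_num)
    rw [hxa, hxa] at h
    norm_cast at h
    obtain ⟨r, hr⟩ := hreal _ (ne_top_of_le_ne_top (EReal.coe_ne_top _) h)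
    rw [hr] at h
    norm_cast at h
    have h1 : sInf S ≤ r + ‖(1 / 2 : ℝ) • x m + (1 - 1 / 2 : ℝ) • x n - f‖ ^ 2 / 2 :=
      csInf_le hSb ⟨_, r, hr, rfl⟩
    have e : (1 / 2 : ℝ) • x m + (1 - 1 / 2 : ℝ) • x n - f
        = (1 / 2 : ℝ) • ((x m - f) + (x n - f)) := by module
    have e2 : x m - x n = (x m - f) - (x n - f) := by abel
    have par := parallelogram_law_with_norm ℝ (x m - f) (x n - f)
    rw [e, norm_smul, mul_pow] at h1
    rw [e2]
    norm_num at h1 h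
    have := hlt m
    have := hlt n
    simp only [one_div] at *
    nlinarith
  have hcau : CauchySeq x := by
    rw [Metric.cauchySeq_iff']
    intro ε hε
    obtain ⟨N, hN⟩ := exists_nat_one_div_lt (show 0 < ε ^ 2 / 8 by positivity)
    refine ⟨N, fun n hn => ?_⟩
    rw [dist_eq_norm]
    refine lt_of_pow_lt_pow_left₀ 2 hε.le ?_
    have h1 : 1 / ((n : ℝ) + 1) ≤ 1 / ((N : ℝ) + 1) := Nat.one_div_le_one_div hn
    linarith [hmid n N]
  obtain ⟨z, hz⟩ := cauchySeq_tendsto_of_complete hcau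
  have hlim : Tendsto (fun n : ℕ => sInf S + 1 / ((n : ℝ) + 1) - ‖x n - f‖ ^ 2 / 2) atTop
      (𝓝 (sInf S + 0 - ‖z - f‖ ^ 2 / 2)) :=
    (tendsto_const_nhds.add tendsto_one_div_add_atTop_nhds_zero_nat).sub
      (((hz.sub_const f).norm.pow 2).div_const 2)
  have hzle : φ z ≤ ((sInf S - ‖z - f‖ ^ 2 / 2 : ℝ) : EReal) := by
    by_contra! hcon
    obtain ⟨q, hq1, hq2⟩ := EReal.lt_iff_exists_real_btwn.1 hcon
    have hev := hz.eventually (hl z _ hq2)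
    norm_cast at hq1
    rw [add_zero] at hlim
    have hev2 := hlim.eventually_lt_const hq1
    obtain ⟨n, h1, h2⟩ := (hev.and hev2).exists
    rw [hxa] at h1
    norm_cast at h1
    linarith [hlt n]
  obtain ⟨b, hzb⟩ := hreal z (ne_top_of_le_ne_top (EReal.coe_ne_top _) hzle)
  refine ⟨z, f - z, sub_mem_subdifferential_of_forall_le hc hbot hzb ?_, by abel⟩
  intro u r hu
  rw [hzb] at hzle
  norm_cast at hzle
  have := csInf_le hSb ⟨u, r, hu, rfl⟩
  linarith

end Hilbert
end ImageRestoring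

/-! ### Calculus of distributional gradients -/

namespace ImageRestoring
open Filter Topology

variable {d : ℕ} {Ω : Set (Rd d)}

theorem inner_gradient_right (ψ : Rd d → ℝ) (x v : Rd d) :
    inner ℝ v (gradient ψ x) = fderiv ℝ ψ x v := by
  rw [real_inner_comm, gradient, InnerProductSpace.toDual_symm_apply]

theorem gradient_apply_eq_fderiv (ψ : Rd d → ℝ) (x : Rd d) (i : Fin d) :
    gradient ψ x i = fderiv ℝ ψ x (EuclideanSpace.single i 1) := by
  rw [← inner_gradient_right]
  rw [EuclideanSpace.inner_single_left]
  simp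

theorem ContDiff.continuous_gradient {ψ : Rd d → ℝ} (h : ContDiff ℝ ∞ ψ) :
    Continuous (gradient ψ) :=
  (InnerProductSpace.toDual ℝ (Rd d)).symm.continuous.comp (h.continuous_fderiv (by simp))

theorem HasCompactSupport.gradient {ψ : Rd d → ℝ} (h : HasCompactSupport ψ) :
    HasCompactSupport (gradient ψ) :=
  (h.fderiv ℝ).comp_left (map_zero _)

theorem gradient_mul {f g : Rd d → ℝ} {x : Rd d} (hf : DifferentiableAt ℝ f x)
    (hg : DifferentiableAt ℝ g x) :
    gradient (fun y => f y * g y) x = f x • gradient g x + g x • gradient f x := by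
  simp only [gradient, ← map_smul, ← map_add]
  congr 1
  exact fderiv_fun_mul hf hg

theorem IsTestFunction.exists_bound {ψ : Rd d → ℝ} (h : IsTestFunction Ω ψ) :
    ∃ C, ∀ x, ‖ψ x‖ ≤ C :=
  h.1.continuous.bounded_above_of_compact_support h.2.1

theorem IsTestFunction.exists_bound_gradient {ψ : Rd d → ℝ} (h : IsTestFunction Ω ψ) :
    ∃ C, ∀ x, ‖gradient ψ x‖ ≤ C :=
  (ContDiff.continuous_gradient h.1).bounded_above_of_compact_support (HasCompactSupport.gradient h.2.1)

theorem abs_apply_le_norm (v : Rd d) (i : Fin d) : ‖v i‖ ≤ ‖v‖ := PiLp.norm_apply_le v i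

theorem continuous_coord (i : Fin d) : Continuous fun v : Rd d => v i := by fun_prop

theorem IsTestFunction.integrable_mul {ψ u : Rd d → ℝ} (h : IsTestFunction Ω ψ)
    (hu : IntegrableOn u Ω) : IntegrableOn (fun x => u x * ψ x) Ω := by
  obtain ⟨C, hC⟩ := h.exists_bound
  exact Integrable.mul_bdd (c := C) hu h.1.continuous.aestronglyMeasurable (Eventually.of_forall hC)

theorem IsTestFunction.integrable_mul_gradient {ψ u : Rd d → ℝ} (h : IsTestFunction Ω ψ)
    (hu : IntegrableOn u Ω) (i : Fin d) : IntegrableOn (fun x => u x * gradient ψ x i) Ω := by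
  obtain ⟨C, hC⟩ := h.exists_bound_gradient
  exact Integrable.mul_bdd (c := C) hu ((continuous_coord i).comp (ContDiff.continuous_gradient h.1)).aestronglyMeasurable
    (Eventually.of_forall fun x => (abs_apply_le_norm _ i).trans (hC x))

theorem _root_.MeasureTheory.IntegrableOn.coord {G : Rd d → Rd d} (hG : IntegrableOn G Ω)
    (i : Fin d) : IntegrableOn (fun x => G x i) Ω :=
  Integrable.mono hG ((continuous_coord i).comp_aestronglyMeasurable hG.aestronglyMeasurable)
    (Eventually.of_forall fun _ => abs_apply_le_norm _ i)

/-- The distributional gradient is unique almost everywhere. -/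
theorem HasWeakGradient.ae_eq (hΩ : IsOpen Ω) {u : Rd d → ℝ} {G G' : Rd d → Rd d}
    (h : HasWeakGradient Ω u G) (h' : HasWeakGradient Ω u G') :
    G =ᵐ[volume.restrict Ω] G' := by
  have hint : ∀ (G : Rd d → Rd d), LocallyIntegrableOn G Ω → ∀ ψ : Rd d → ℝ, Continuous ψ →
      HasCompactSupport ψ → tsupport ψ ⊆ Ω → Integrable (fun x => ψ x • G x) (volume.restrict Ω) := by
    intro G hG ψ hc hs ht
    have h1 : IntegrableOn (fun x => ψ x • G x) (tsupport ψ) :=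
      (hG.integrableOn_compact_subset ht hs).continuousOn_smul hc.continuousOn hs
    have h2 : Integrable (fun x => ψ x • G x) := by
      rwa [integrableOn_iff_integrable_of_support_subset] at h1
      intro x hx
      apply subset_tsupport
      intro h0
      simp [h0] at hx
    exact h2.integrableOn
  -- The fundamental lemma of the calculus of variations for the vector field `G - G'`; its
  -- hypothesis is checked coordinate by coordinate.
  have hz := hΩ.ae_eq_zero_of_integral_contDiff_smul_eq_zero (h.2.1.sub h'.2.1) (fun ψ hψ hs ht => by
    have hψ' : IsTestFunction Ω ψ := ⟨hψ, hs, ht⟩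
    have i1 := hint G h.2.1 ψ hψ.continuous hs ht
    have i2 := hint G' h'.2.1 ψ hψ.continuous hs ht
    have e0 : ∫ x, ψ x • (G - G') x = ∫ x in Ω, (ψ x • G x - ψ x • G' x) := by
      rw [setIntegral_eq_integral_of_forall_compl_eq_zero]
      · simp [smul_sub]
      · intro x hx
        have : ψ x = 0 := image_eq_zero_of_notMem_tsupport fun hh => hx (ht hh)
        simp [this]
    rw [e0, integral_sub i1 i2, sub_eq_zero]
    ext i
    have p1 := (PiLp.proj 2 (fun _ : Fin d => ℝ) i : Rd d →L[ℝ] ℝ).integral_comp_comm i1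
    have p2 := (PiLp.proj 2 (fun _ : Fin d => ℝ) i : Rd d →L[ℝ] ℝ).integral_comp_comm i2
    simp only [PiLp.proj_apply] at p1 p2
    rw [← p1, ← p2]
    have q1 := h.2.2 ψ hψ' i
    have q2 := h'.2.2 ψ hψ' i
    rw [q1] at q2
    simpa [mul_comm] using q2)
  rw [EventuallyEq, ae_restrict_iff' hΩ.measurableSet]
  filter_upwards [hz] with x hx hxΩ
  exact sub_eq_zero.1 (hx hxΩ)

theorem hasWeakGradient_of_integrableOn {u : Rd d → ℝ} {G : Rd d → Rd d} (hu : IntegrableOn u Ω)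
    (hG : IntegrableOn G Ω) (h : ∀ ψ : Rd d → ℝ, IsTestFunction Ω ψ → ∀ i : Fin d,
      ∫ x in Ω, u x * (gradient ψ x) i = - ∫ x in Ω, (G x) i * ψ x) : HasWeakGradient Ω u G :=
  ⟨hu.locallyIntegrableOn, hG.locallyIntegrableOn, h⟩

theorem HasWeakGradient.congr {u u' : Rd d → ℝ} {G G' : Rd d → Rd d}
    (h : HasWeakGradient Ω u G) (hu' : IntegrableOn u' Ω) (hG' : IntegrableOn G' Ω)
    (hu : u =ᵐ[volume.restrict Ω] u') (hG : G =ᵐ[volume.restrict Ω] G') :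
    HasWeakGradient Ω u' G' := by
  refine hasWeakGradient_of_integrableOn hu' hG' fun ψ hψ i => ?_
  have e1 : ∫ x in Ω, u' x * (gradient ψ x) i = ∫ x in Ω, u x * (gradient ψ x) i :=
    integral_congr_ae (by filter_upwards [hu] with x hx; rw [hx])
  have e2 : ∫ x in Ω, (G' x) i * ψ x = ∫ x in Ω, (G x) i * ψ x :=
    integral_congr_ae (by filter_upwards [hG] with x hx; rw [hx])
  rw [e1, e2, h.2.2 ψ hψ i]

theorem HasWeakGradient.weakGradient_spec {u : Rd d → ℝ} {G : Rd d → Rd d}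
    (h : HasWeakGradient Ω u G) : HasWeakGradient Ω u (weakGradient Ω u) := by
  have hex : ∃ G : Rd d → Rd d, HasWeakGradient Ω u G := ⟨G, h⟩
  rw [weakGradient, dif_pos hex]
  exact hex.choose_spec

theorem HasWeakGradient.weakGradient_ae_eq (hΩ : IsOpen Ω) {u : Rd d → ℝ} {G : Rd d → Rd d}
    (h : HasWeakGradient Ω u G) : weakGradient Ω u =ᵐ[volume.restrict Ω] G :=
  h.weakGradient_spec.ae_eq hΩ h

theorem HasWeakGradient.add {u v : Rd d → ℝ} {G K : Rd d → Rd d}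
    (hu : IntegrableOn u Ω) (hG : IntegrableOn G Ω) (hv : IntegrableOn v Ω) (hK : IntegrableOn K Ω)
    (h : HasWeakGradient Ω u G) (h' : HasWeakGradient Ω v K) :
    HasWeakGradient Ω (fun x => u x + v x) (fun x => G x + K x) := by
  refine hasWeakGradient_of_integrableOn (hu.add hv) (hG.add hK) fun ψ hψ i => ?_
  simp only [PiLp.add_apply, add_mul]
  rw [integral_add (hψ.integrable_mul_gradient hu i) (hψ.integrable_mul_gradient hv i),
    integral_add (hψ.integrable_mul (hG.coord i)) (hψ.integrable_mul (hK.coord i)),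
    h.2.2 ψ hψ i, h'.2.2 ψ hψ i]
  ring

theorem HasWeakGradient.const_mul {u : Rd d → ℝ} {G : Rd d → Rd d}
    (h : HasWeakGradient Ω u G) (hu : IntegrableOn u Ω) (hG : IntegrableOn G Ω) (c : ℝ) :
    HasWeakGradient Ω (fun x => c * u x) (fun x => c • G x) := by
  refine hasWeakGradient_of_integrableOn (hu.const_mul c) (hG.smul c) fun ψ hψ i => ?_
  simp only [PiLp.smul_apply, smul_eq_mul, mul_assoc, integral_const_mul]
  rw [h.2.2 ψ hψ i]
  ring

theorem IsTestFunction.smul_left {θ ψ : Rd d → ℝ} (hψ : IsTestFunction Ω ψ)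
    (hθ : ContDiff ℝ ∞ θ) : IsTestFunction Ω (fun x => θ x * ψ x) :=
  ⟨hθ.mul hψ.1, hψ.2.1.mul_left, (tsupport_mul_subset_right (f := θ) (g := ψ)).trans hψ.2.2⟩

/-- Leibniz rule for the product with a smooth function. -/
theorem HasWeakGradient.smooth_mul {u θ : Rd d → ℝ} {G : Rd d → Rd d}
    (h : HasWeakGradient Ω u G) (hθ : ContDiff ℝ ∞ θ)
    (hu : IntegrableOn u Ω) (hG : IntegrableOn G Ω)
    (hu' : IntegrableOn (fun x => θ x * u x) Ω)
    (hG' : IntegrableOn (fun x => θ x • G x + u x • gradient θ x) Ω) :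
    HasWeakGradient Ω (fun x => θ x * u x) (fun x => θ x • G x + u x • gradient θ x) := by
  refine hasWeakGradient_of_integrableOn hu' hG' fun ψ hψ i => ?_
  have hθψ := hψ.smul_left hθ
  have h1 := h.2.2 _ hθψ i
  have hd : ∀ x, gradient (fun x => θ x * ψ x) x = θ x • gradient ψ x + ψ x • gradient θ x :=
    fun x => gradient_mul (hθ.differentiable (by simp) x) (hψ.1.differentiable (by simp) x)
  have i2 : IntegrableOn (fun x => G x i * (θ x * ψ x)) Ω := hθψ.integrable_mul (hG.coord i)
  have i3 : IntegrableOn (fun x => (θ x * u x) * gradient ψ x i) Ω :=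
    hψ.integrable_mul_gradient hu' i
  -- Since `θ` and its gradient are not assumed bounded, integrability comes by subtraction from the
  -- test function `θ ψ`.
  have i4 : IntegrableOn (fun x => u x * (ψ x * gradient θ x i)) Ω := by
    have := hθψ.integrable_mul_gradient hu i
    refine (this.sub i3).congr (Eventually.of_forall fun x => ?_)
    simp only [Pi.sub_apply, hd, PiLp.add_apply, PiLp.smul_apply, smul_eq_mul]
    ring
  have e1 : ∫ x in Ω, u x * gradient (fun x => θ x * ψ x) x i
      = (∫ x in Ω, (θ x * u x) * gradient ψ x i) + ∫ x in Ω, u x * (ψ x * gradient θ x i) := by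
    rw [← integral_add i3 i4]
    refine integral_congr_ae (Eventually.of_forall fun x => ?_)
    simp only [hd, PiLp.add_apply, PiLp.smul_apply, smul_eq_mul]
    ring
  have e2 : ∫ x in Ω, (θ x • G x + u x • gradient θ x) i * ψ x
      = (∫ x in Ω, G x i * (θ x * ψ x)) + ∫ x in Ω, u x * (ψ x * gradient θ x i) := by
    rw [← integral_add i2 i4]
    refine integral_congr_ae (Eventually.of_forall fun x => ?_)
    simp only [PiLp.add_apply, PiLp.smul_apply, smul_eq_mul]
    ring
  rw [e2]
  rw [e1] at h1
  linarith

theorem IsC1UpToBoundary.gradient_eqOn {ψ : Rd d → ℝ} (h : IsC1UpToBoundary Ω ψ) :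
    ∃ D : Rd d → Rd d, ContinuousOn D (closure Ω) ∧ (∀ x ∈ Ω, DifferentiableAt ℝ ψ x) ∧
      ∀ x ∈ Ω, gradient ψ x = D x := by
  obtain ⟨-, D, hD, hg⟩ := h
  exact ⟨D, hD, fun x hx => (hg x hx).differentiableAt, fun x hx => (hg x hx).gradient⟩

theorem exists_bound_of_continuousOn_closure {E : Type*} [NormedAddCommGroup E] {f : Rd d → E}
    (hb : Bornology.IsBounded Ω) (hf : ContinuousOn f (closure Ω)) :
    ∃ C, 0 ≤ C ∧ ∀ x ∈ Ω, ‖f x‖ ≤ C := by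
  obtain ⟨C, hC⟩ := hb.isCompact_closure.exists_bound_of_continuousOn hf
  exact ⟨max C 0, le_max_right _ _, fun x hx => (hC x (subset_closure hx)).trans (le_max_left _ _)⟩

theorem isFiniteMeasure_restrict_of_isBounded (hb : Bornology.IsBounded Ω) :
    IsFiniteMeasure (volume.restrict Ω) :=
  ⟨by rw [Measure.restrict_apply_univ]; exact hb.measure_lt_top⟩

theorem memLp_of_continuousOn_closure {E : Type*} [NormedAddCommGroup E]
    [SecondCountableTopology E] {f g : Rd d → E}
    (hΩ : IsOpen Ω) (hb : Bornology.IsBounded Ω) (hf : ContinuousOn f (closure Ω))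
    (hfg : ∀ x ∈ Ω, g x = f x) (q : ℝ≥0∞) : MemLp g q (volume.restrict Ω) := by
  have := isFiniteMeasure_restrict_of_isBounded hb
  obtain ⟨C, -, hC⟩ := exists_bound_of_continuousOn_closure hb hf
  have hm : AEStronglyMeasurable f (volume.restrict Ω) :=
    (hf.mono subset_closure).aestronglyMeasurable hΩ.measurableSet
  have : MemLp f q (volume.restrict Ω) := MemLp.of_bound hm C
    ((ae_restrict_iff' hΩ.measurableSet).2 (Eventually.of_forall hC))
  exact this.ae_eq ((ae_restrict_iff' hΩ.measurableSet).2
    (Eventually.of_forall fun x hx => (hfg x hx).symm))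

theorem IsC1UpToBoundary.memLp (hΩ : IsOpen Ω) (hb : Bornology.IsBounded Ω) {ψ : Rd d → ℝ}
    (h : IsC1UpToBoundary Ω ψ) (q : ℝ≥0∞) : MemLp ψ q (volume.restrict Ω) :=
  memLp_of_continuousOn_closure hΩ hb h.1 (fun _ _ => rfl) q

theorem IsC1UpToBoundary.memLp_gradient (hΩ : IsOpen Ω) (hb : Bornology.IsBounded Ω)
    {ψ : Rd d → ℝ} (h : IsC1UpToBoundary Ω ψ) (q : ℝ≥0∞) :
    MemLp (gradient ψ) q (volume.restrict Ω) := by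
  obtain ⟨D, hD, -, hg⟩ := h.gradient_eqOn
  exact memLp_of_continuousOn_closure hΩ hb hD hg q

/-- On `C¹(Ω̄)` the distributional gradient is the classical one. -/
theorem IsC1UpToBoundary.hasWeakGradient (hΩ : IsOpen Ω) (hb : Bornology.IsBounded Ω)
    {ψ : Rd d → ℝ} (h : IsC1UpToBoundary Ω ψ) : HasWeakGradient Ω ψ (gradient ψ) := by
  have := isFiniteMeasure_restrict_of_isBounded hb
  have hψi : IntegrableOn ψ Ω := (h.memLp hΩ hb 1).integrable le_rfl
  have hDi : IntegrableOn (gradient ψ) Ω := (h.memLp_gradient hΩ hb 1).integrable le_rfl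
  refine hasWeakGradient_of_integrableOn hψi hDi fun η hη i => ?_
  obtain ⟨D, hD, hdiff, hg⟩ := h.gradient_eqOn
  have i1 := hη.integrable_mul_gradient hψi i
  have i2 := hη.integrable_mul (hDi.coord i)
  have hηd : Differentiable ℝ η := hη.1.differentiable (by simp)
  -- As `η` vanishes near every point outside `Ω`, the product is differentiable on all of `ℝ^d`,
  -- whatever `ψ` does there.
  set F : Rd d → ℝ := fun x => ψ x * η x
  have hzero : ∀ x ∉ Ω, F =ᶠ[𝓝 x] 0 := by
    intro x hx
    have : x ∈ (tsupport η)ᶜ := fun hh => hx (hη.2.2 hh)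
    filter_upwards [(isClosed_tsupport η).isOpen_compl.mem_nhds this] with y hy
    simp [F, image_eq_zero_of_notMem_tsupport hy]
  have hFd : Differentiable ℝ F := by
    intro x
    by_cases hx : x ∈ Ω
    · exact (hdiff x hx).mul (hηd x)
    · exact (differentiableAt_const (0 : ℝ)).congr_of_eventuallyEq (hzero x hx)
  have hFg : ∀ x ∈ Ω, fderiv ℝ F x (EuclideanSpace.single i 1)
      = ψ x * gradient η x i + gradient ψ x i * η x := by
    intro x hx
    rw [← gradient_apply_eq_fderiv, gradient_mul (hdiff x hx) (hηd x)]
    simp only [PiLp.add_apply, PiLp.smul_apply, smul_eq_mul]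
    ring
  have hF0 : ∀ x ∉ Ω, fderiv ℝ F x (EuclideanSpace.single i 1) = 0 := by
    intro x hx
    rw [(hzero x hx).fderiv_eq]
    simp
  have hFz : ∀ x ∉ Ω, F x = 0 := fun x hx => (hzero x hx).self_of_nhds
  have j1 : Integrable F := by
    have : IntegrableOn F Ω := hη.integrable_mul hψi
    rwa [integrableOn_iff_integrable_of_support_subset] at this
    exact fun x hx => by_contra fun hh => hx (hFz x hh)
  have j2 : Integrable fun x => fderiv ℝ F x (EuclideanSpace.single i 1) := by
    have : IntegrableOn (fun x => fderiv ℝ F x (EuclideanSpace.single i 1)) Ω :=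
      (i1.add i2).congr ((ae_restrict_iff' hΩ.measurableSet).2
        (Eventually.of_forall fun x hx => (hFg x hx).symm))
    rwa [integrableOn_iff_integrable_of_support_subset] at this
    exact fun x hx => by_contra fun hh => hx (hF0 x hh)
  -- Integration by parts against the constant `1`: the integral of `∂ᵢF` over the whole space is
  -- zero.
  have key := integral_mul_fderiv_eq_neg_fderiv_mul_of_integrable (μ := (volume : Measure (Rd d)))
    (f := fun _ => (1 : ℝ)) (g := F) (v := EuclideanSpace.single i 1)
    (by simp) (by simpa using j2) (by simpa using j1)
    (fun _ _ => differentiableAt_const _) (fun x _ => hFd x)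
  simp only [one_mul, fderiv_fun_const, Pi.zero_apply, zero_apply, zero_mul,
    integral_zero, neg_zero] at key
  rw [← setIntegral_eq_integral_of_forall_compl_eq_zero hF0,
    setIntegral_congr_fun hΩ.measurableSet hFg, integral_add i1 i2] at key
  linarith

theorem isC1UpToBoundary_of_contDiff {ψ : Rd d → ℝ} (h : ContDiff ℝ ∞ ψ) :
    IsC1UpToBoundary Ω ψ :=
  ⟨h.continuous.continuousOn, gradient ψ, (ContDiff.continuous_gradient h).continuousOn,
    fun x _ => (h.differentiable (by simp) x).hasGradientAt⟩

end ImageRestoring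

/-! ### Convex integrands with `p`-growth, and Hölder pairings -/

namespace ImageRestoring
open Filter Topology

variable {d : ℕ} {Ω : Set (Rd d)} {j : Rd d → ℝ} {p : ℝ}

section ConvexDifferentiable

theorem tendsto_slope_inner_gradient (hjd : Differentiable ℝ j) (x v : Rd d) :
    Tendsto (fun t : ℝ => t⁻¹ * (j (x + t • v) - j x)) (𝓝[>] 0) (𝓝 (inner ℝ (gradient j x) v)) := by
  have h := ((hjd x).hasFDerivAt.hasLineDerivAt v).tendsto_slope_zero_right
  rw [real_inner_comm, inner_gradient_right]
  exact h

theorem ConvexOn.slope_le (hjc : ConvexOn ℝ univ j) (x v : Rd d) {t : ℝ} (ht : 0 < t)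
    (ht1 : t ≤ 1) : t⁻¹ * (j (x + t • v) - j x) ≤ j (x + v) - j x := by
  have h := hjc.2 (mem_univ (x + v)) (mem_univ x) ht.le (sub_nonneg.2 ht1) (by ring)
  have e : t • (x + v) + (1 - t) • x = x + t • v := by module
  rw [e, smul_eq_mul, smul_eq_mul] at h
  rw [inv_mul_le_iff₀ ht]
  linarith

theorem ConvexOn.inner_gradient_le (hjc : ConvexOn ℝ univ j) (hjd : Differentiable ℝ j)
    (x v : Rd d) : inner ℝ (gradient j x) v ≤ j (x + v) - j x := by
  refine le_of_tendsto (tendsto_slope_inner_gradient hjd x v) ?_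
  filter_upwards [Ioo_mem_nhdsGT (zero_lt_one (α := ℝ))] with t ht
  exact ConvexOn.slope_le hjc x v ht.1 ht.2.le

theorem ConvexOn.inner_gradient_le_slope (hjc : ConvexOn ℝ univ j) (hjd : Differentiable ℝ j)
    (x v : Rd d) {t : ℝ} (ht : 0 < t) :
    inner ℝ (gradient j x) v ≤ t⁻¹ * (j (x + t • v) - j x) := by
  have := ConvexOn.inner_gradient_le hjc hjd x (t • v)
  rw [inner_smul_right] at this
  rwa [le_inv_mul_iff₀ ht]

theorem measurable_gradient (j : Rd d → ℝ) : Measurable (gradient j) :=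
  (InnerProductSpace.toDual ℝ (Rd d)).symm.continuous.measurable.comp (measurable_fderiv ℝ j)

/-- In the gradient inequality at `r`, a step `h` along `∇j(r)` gives `‖∇j(r)‖ ‖h‖ ≤ j(r + h) -
j(r)`. With `‖h‖ = 1 + ‖r‖` the right side is of order `(1 + ‖r‖)^p` by the two-sided growth, and
dividing by `‖h‖` lowers the exponent by one. -/
theorem exists_norm_gradient_le (hjc : ConvexOn ℝ univ j) (hjd : Differentiable ℝ j)
    {ω₁ ω₂ C₁ C₂ : ℝ} (hp : 1 < p) (hω₁ : 0 < ω₁) (hω₂ : 0 < ω₂)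
    (hj : ∀ r : Rd d, ω₁ * ‖r‖ ^ p + C₁ ≤ j r ∧ j r ≤ ω₂ * ‖r‖ ^ p + C₂) :
    ∃ K, 0 ≤ K ∧ ∀ r, ‖gradient j r‖ ≤ K * (1 + ‖r‖) ^ (p - 1) := by
  refine ⟨ω₂ * 2 ^ p + |C₂ - C₁|, by positivity, fun r => ?_⟩
  set b := gradient j r with hb
  rcases eq_or_ne b 0 with h0 | h0
  · rw [h0, norm_zero]; positivity
  have hb0 : 0 < ‖b‖ := norm_pos_iff.2 h0
  set h : Rd d := ((1 + ‖r‖) / ‖b‖) • b with hh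
  have hs : 0 < 1 + ‖r‖ := by positivity
  have hn : ‖h‖ = 1 + ‖r‖ := by
    rw [hh, norm_smul, Real.norm_of_nonneg (by positivity)]
    field_simp
  have hi : inner ℝ b h = (1 + ‖r‖) * ‖b‖ := by
    rw [hh, inner_smul_right, real_inner_self_eq_norm_sq]
    field_simp
  have h1 := ConvexOn.inner_gradient_le hjc hjd r h
  rw [← hb, hi] at h1
  have h2 := (hj (r + h)).2
  have h3 := (hj r).1
  have h4 : ‖r + h‖ ^ p ≤ 2 ^ p * (1 + ‖r‖) ^ p := by
    rw [← Real.mul_rpow (by norm_num) hs.le]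
    refine Real.rpow_le_rpow (norm_nonneg _) ?_ (by linarith)
    have := norm_add_le r h
    linarith
  have h5 : 0 ≤ ω₁ * ‖r‖ ^ p := by positivity
  have h6 : 1 ≤ (1 + ‖r‖) ^ p := Real.one_le_rpow (by linarith [norm_nonneg r]) (by linarith)
  have h7 : C₂ - C₁ ≤ |C₂ - C₁| * (1 + ‖r‖) ^ p :=
    (le_abs_self _).trans (le_mul_of_one_le_right (abs_nonneg _) h6)
  have h8 : (1 + ‖r‖) ^ p = (1 + ‖r‖) ^ (p - 1) * (1 + ‖r‖) := by
    rw [← Real.rpow_add_one hs.ne']; congr 1; ring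
  have h9 : ω₂ * ‖r + h‖ ^ p ≤ ω₂ * (2 ^ p * (1 + ‖r‖) ^ p) := by gcongr
  have h10 : ‖b‖ * (1 + ‖r‖) ≤ (ω₂ * 2 ^ p + |C₂ - C₁|) * (1 + ‖r‖) ^ (p - 1) * (1 + ‖r‖) := by
    rw [mul_assoc, ← h8]
    linarith
  exact le_of_mul_le_mul_right h10 hs

end ConvexDifferentiable

section Composition

variable {α : Type*} {m : MeasurableSpace α} {μ : Measure α}

theorem integrable_norm_rpow_of_memLp [IsFiniteMeasure μ] (hp : 1 < p) {G : α → Rd d}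
    (hG : MemLp G (ENNReal.ofReal p) μ) : Integrable (fun x => ‖G x‖ ^ p) μ := by
  have := hG.integrable_norm_rpow'
  rwa [ENNReal.toReal_ofReal (by linarith)] at this

theorem integrable_comp_of_growth [IsFiniteMeasure μ] (hjm : Continuous j)
    {ω₁ ω₂ C₁ C₂ : ℝ} (hp : 1 < p)
    (hj : ∀ r : Rd d, ω₁ * ‖r‖ ^ p + C₁ ≤ j r ∧ j r ≤ ω₂ * ‖r‖ ^ p + C₂) {G : α → Rd d}
    (hG : MemLp G (ENNReal.ofReal p) μ) : Integrable (fun x => j (G x)) μ := by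
  have h1 := integrable_norm_rpow_of_memLp hp hG
  refine integrable_of_le_of_le (hjm.comp_aestronglyMeasurable hG.1)
    (Eventually.of_forall fun x => (hj (G x)).1) (Eventually.of_forall fun x => (hj (G x)).2)
    ((h1.const_mul _).add (integrable_const _)) ((h1.const_mul _).add (integrable_const _))

/-- The exponent `p / (p - 1)` is conjugate to `p`, so `β(∇u)` pairs with gradients of `W^{1,p}`
functions. -/
theorem memLp_gradient_comp [IsFiniteMeasure μ] {K : ℝ} (hp : 1 < p)
    (hK : ∀ r, ‖gradient j r‖ ≤ K * (1 + ‖r‖) ^ (p - 1)) {G : α → Rd d}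
    (hG : MemLp G (ENNReal.ofReal p) μ) :
    MemLp (fun x => gradient j (G x)) (ENNReal.ofReal (p / (p - 1))) μ := by
  have h1 : MemLp (fun x => 1 + ‖G x‖) (ENNReal.ofReal p) μ := by
    have h0 : MemLp (fun _ : α => (1 : ℝ)) (ENNReal.ofReal p) μ := memLp_const 1
    exact h0.add hG.norm
  have h2 := (h1.norm_rpow_div (ENNReal.ofReal (p - 1))).const_mul K
  rw [ENNReal.toReal_ofReal (by linarith), ← ENNReal.ofReal_div_of_pos (by linarith)] at h2
  refine h2.mono ?_ ?_
  · exact ((measurable_gradient j).comp_aemeasurable hG.1.aemeasurable).aestronglyMeasurable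
  · refine Eventually.of_forall fun x => (hK (G x)).trans (le_trans ?_ (le_abs_self _))
    rw [Real.norm_of_nonneg (by positivity : 0 ≤ 1 + ‖G x‖)]

theorem holderConjugate_ofReal (hp : 1 < p) :
    ENNReal.HolderConjugate (ENNReal.ofReal (p / (p - 1))) (ENNReal.ofReal p) := by
  have : (p / (p - 1)).HolderConjugate p := (Real.HolderConjugate.conjExponent hp).symm
  exact this.ennrealOfReal

theorem eLpNorm_inner_le {E : Type*} [NormedAddCommGroup E] [InnerProductSpace ℝ E]
    {a b : ℝ≥0∞} [ENNReal.HolderConjugate a b]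
    {F G : α → E} (hF : AEStronglyMeasurable F μ) (hG : AEStronglyMeasurable G μ) :
    eLpNorm (fun x => inner ℝ (F x) (G x)) 1 μ ≤ eLpNorm F a μ * eLpNorm G b μ := by
  have := eLpNorm_le_eLpNorm_mul_eLpNorm'_of_norm (p := a) (q := b) (r := 1) hF hG
    (fun x y => inner ℝ x y) 1 (Eventually.of_forall fun x => by
      simpa using norm_inner_le_norm (𝕜 := ℝ) (F x) (G x))
  simpa using this

theorem integrable_inner_of_memLp {E : Type*} [NormedAddCommGroup E] [InnerProductSpace ℝ E]
    {a b : ℝ≥0∞} [ENNReal.HolderConjugate a b]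
    {F G : α → E} (hF : MemLp F a μ) (hG : MemLp G b μ) :
    Integrable (fun x => inner ℝ (F x) (G x)) μ := by
  rw [← memLp_one_iff_integrable]
  exact ⟨hF.1.inner hG.1, (eLpNorm_inner_le (a := a) (b := b) hF.1 hG.1).trans_lt
    (ENNReal.mul_lt_top hF.2 hG.2)⟩

theorem tendsto_integral_inner_of_tendsto_eLpNorm {E : Type*} [NormedAddCommGroup E]
    [InnerProductSpace ℝ E] {a b : ℝ≥0∞} [ENNReal.HolderConjugate a b] {F : α → E}
    {G : ℕ → α → E} {G₀ : α → E} (hF : MemLp F a μ) (hG : ∀ n, MemLp (G n) b μ)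
    (hG₀ : MemLp G₀ b μ) (h : Tendsto (fun n => eLpNorm (fun x => G n x - G₀ x) b μ) atTop (𝓝 0)) :
    Tendsto (fun n => ∫ x, inner ℝ (F x) (G n x) ∂μ) atTop (𝓝 (∫ x, inner ℝ (F x) (G₀ x) ∂μ)) := by
  refine tendsto_integral_of_L1' _ (integrable_inner_of_memLp (a := a) (b := b) hF hG₀).aestronglyMeasurable
    (Eventually.of_forall fun n => integrable_inner_of_memLp (a := a) (b := b) hF (hG n)) ?_
  have h1 : Tendsto (fun n => eLpNorm F a μ * eLpNorm (fun x => G n x - G₀ x) b μ) atTop (𝓝 0) := by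
    simpa using ENNReal.Tendsto.const_mul h (Or.inr hF.2.ne)
  refine tendsto_of_tendsto_of_tendsto_of_le_of_le tendsto_const_nhds h1 (fun _ => zero_le)
    fun n => le_trans (le_of_eq ?_) (eLpNorm_inner_le (a := a) (b := b) hF.1 ((hG n).sub hG₀).1)
  congr 1
  ext x
  simp [inner_sub_right]

end Composition

end ImageRestoring

/-! ### Values and convexity of the energy -/

namespace ImageRestoring
open Filter Topology

variable {d : ℕ} {Ω : Set (Rd d)} {j : Rd d → ℝ} {p : ℝ}

theorem one_le_ofReal (hp : 1 < p) : 1 ≤ ENNReal.ofReal p := by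
  rw [← ENNReal.ofReal_one]
  exact ENNReal.ofReal_le_ofReal hp.le

theorem integrableOn_of_memLp {E : Type*} [NormedAddCommGroup E] (hb : Bornology.IsBounded Ω)
    {q : ℝ≥0∞} (hq : 1 ≤ q) {f : Rd d → E} (hf : MemLp f q (volume.restrict Ω)) :
    IntegrableOn f Ω := by
  have := isFiniteMeasure_restrict_of_isBounded hb
  exact hf.integrable hq

theorem L2.integrableOn (hb : Bornology.IsBounded Ω) (u : L2 Ω) : IntegrableOn u Ω :=
  integrableOn_of_memLp hb (by norm_num) (Lp.memLp u)

theorem MemW1p.weakGradient_spec (hΩ : IsOpen Ω) {u : Rd d → ℝ} (h : MemW1p Ω p u) :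
    HasWeakGradient Ω u (weakGradient Ω u) ∧
      MemLp (weakGradient Ω u) (ENNReal.ofReal p) (volume.restrict Ω) := by
  obtain ⟨-, G, hG, hGp⟩ := h
  exact ⟨hG.weakGradient_spec, hGp.ae_eq (hG.weakGradient_ae_eq hΩ).symm⟩

theorem HasWeakGradient.smul_add_smul (hb : Bornology.IsBounded Ω) (hp : 1 < p) {u v : L2 Ω}
    {G K : Rd d → Rd d} (hu : HasWeakGradient Ω u G) (hv : HasWeakGradient Ω v K)
    (hG : MemLp G (ENNReal.ofReal p) (volume.restrict Ω))
    (hK : MemLp K (ENNReal.ofReal p) (volume.restrict Ω)) (s t : ℝ) :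
    HasWeakGradient Ω (s • u + t • v : L2 Ω) (fun x => s • G x + t • K x) := by
  have hG1 := integrableOn_of_memLp hb (one_le_ofReal hp) hG
  have hK1 := integrableOn_of_memLp hb (one_le_ofReal hp) hK
  have hu1 := L2.integrableOn hb u
  have hv1 := L2.integrableOn hb v
  refine ((hu.const_mul hu1 hG1 s).add (hu1.const_mul s) (hG1.smul s) (hv1.const_mul t)
    (hK1.smul t) (hv.const_mul hv1 hK1 t)).congr (L2.integrableOn hb _)
    ((hG1.smul s).add (hK1.smul t)) ?_ EventuallyEq.rfl
  filter_upwards [Lp.coeFn_add (s • u) (t • v), Lp.coeFn_smul s u, Lp.coeFn_smul t v] with x h1 h2 h3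
  rw [h1, Pi.add_apply, h2, h3]
  rfl

theorem memLp_smul_add_smul {u v : L2 Ω} (hu : MemLp u (ENNReal.ofReal p) (volume.restrict Ω))
    (hv : MemLp v (ENNReal.ofReal p) (volume.restrict Ω)) (s t : ℝ) :
    MemLp (s • u + t • v : L2 Ω) (ENNReal.ofReal p) (volume.restrict Ω) := by
  refine ((hu.const_smul s).add (hv.const_smul t)).ae_eq ?_
  filter_upwards [Lp.coeFn_add (s • u) (t • v), Lp.coeFn_smul s u, Lp.coeFn_smul t v] with x h1 h2 h3
  rw [h1, Pi.add_apply, Pi.add_apply, h2, h3]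

/-- The energy is defined through a chosen gradient; almost everywhere uniqueness allows it to be
computed with any other. -/
theorem energy_eq_integral (hΩ : IsOpen Ω) {u : L2 Ω} {G : Rd d → Rd d}
    (hu : MemLp u (ENNReal.ofReal p) (volume.restrict Ω)) (hG : HasWeakGradient Ω u G)
    (hGp : MemLp G (ENNReal.ofReal p) (volume.restrict Ω))
    (hi : Integrable (fun x => j (G x)) (volume.restrict Ω)) :
    energy Ω p j u = ((∫ x in Ω, j (G x) : ℝ) : EReal) := by
  have hae : (fun x => j (weakGradient Ω u x)) =ᵐ[volume.restrict Ω] fun x => j (G x) := by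
    filter_upwards [hG.weakGradient_ae_eq hΩ] with x hx
    rw [hx]
  rw [energy, if_pos ⟨⟨hu, G, hG, hGp⟩, hi.congr hae.symm⟩, integral_congr_ae hae]

theorem energy_ne_top (hΩ : IsOpen Ω) {u : L2 Ω} (h : energy Ω p j u ≠ ⊤) :
    ∃ G : Rd d → Rd d, MemLp u (ENNReal.ofReal p) (volume.restrict Ω) ∧ HasWeakGradient Ω u G ∧
      MemLp G (ENNReal.ofReal p) (volume.restrict Ω) ∧
      Integrable (fun x => j (G x)) (volume.restrict Ω) ∧
      energy Ω p j u = ((∫ x in Ω, j (G x) : ℝ) : EReal) := by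
  rw [energy] at h
  split_ifs at h with hc
  · have := hc.1.weakGradient_spec hΩ
    refine ⟨_, hc.1.1, this.1, this.2, hc.2, ?_⟩
    rw [energy, if_pos hc]
  · exact absurd rfl h

theorem le_energy (hb : Bornology.IsBounded Ω) {c : ℝ} (hc : ∀ r, c ≤ j r) (u : L2 Ω) :
    ((c * volume.real Ω : ℝ) : EReal) ≤ energy Ω p j u := by
  have := isFiniteMeasure_restrict_of_isBounded hb
  rw [energy]
  split_ifs with h
  · norm_cast
    have := integral_mono (integrable_const c) h.2 (fun x => hc _)
    simpa [mul_comm] using this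
  · exact le_top

theorem energy_ne_bot (u : L2 Ω) : energy Ω p j u ≠ ⊥ := by
  rw [energy]
  split_ifs with h
  · exact EReal.coe_ne_bot _
  · simp

theorem energy_zero_ne_top (hΩ : IsOpen Ω) (hb : Bornology.IsBounded Ω) :
    energy Ω p j (0 : L2 Ω) ≠ ⊤ := by
  have := isFiniteMeasure_restrict_of_isBounded hb
  have h0 : HasWeakGradient Ω (0 : L2 Ω) 0 := by
    refine (hasWeakGradient_of_integrableOn (u := 0) (G := 0) (integrable_zero _ _ _)
      (integrable_zero _ _ _) ?_).congr (L2.integrableOn hb _) (integrable_zero _ _ _)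
      (Lp.coeFn_zero _ _ _).symm EventuallyEq.rfl
    simp
  rw [energy_eq_integral hΩ (MemLp.ae_eq (Lp.coeFn_zero ..).symm MemLp.zero) h0 MemLp.zero
    ((integrable_const (j 0)).congr (Eventually.of_forall fun _ => rfl))]
  exact EReal.coe_ne_top _

theorem isConvexFunctional_energy (hΩ : IsOpen Ω) (hb : Bornology.IsBounded Ω) (hp : 1 < p)
    (hjc : ConvexOn ℝ univ j) (hint : ∀ G : Rd d → Rd d,
      MemLp G (ENNReal.ofReal p) (volume.restrict Ω) →
      Integrable (fun x => j (G x)) (volume.restrict Ω)) :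
    IsConvexFunctional (energy Ω p j) := by
  intro u v t ht ht1
  have ht2 : 0 < 1 - t := by linarith
  by_cases hu : energy Ω p j u = ⊤
  · rw [hu, EReal.coe_mul_top_of_pos ht, EReal.top_add_of_ne_bot]
    · exact le_top
    · by_cases hv : energy Ω p j v = ⊤
      · rw [hv, EReal.coe_mul_top_of_pos ht2]; simp
      · obtain ⟨K, -, -, -, -, hvK⟩ := energy_ne_top hΩ hv
        rw [hvK]
        exact_mod_cast EReal.coe_ne_bot _
  by_cases hv : energy Ω p j v = ⊤
  · obtain ⟨G, -, -, -, -, huG⟩ := energy_ne_top hΩ hu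
    rw [hv, EReal.coe_mul_top_of_pos ht2, EReal.add_top_of_ne_bot]
    · exact le_top
    · rw [huG]
      exact_mod_cast EReal.coe_ne_bot _
  obtain ⟨G, hup, hG, hGp, hGi, huG⟩ := energy_ne_top hΩ hu
  obtain ⟨K, hvp, hK, hKp, hKi, hvK⟩ := energy_ne_top hΩ hv
  have hi := hint _ ((hGp.const_smul t).add (hKp.const_smul (1 - t)))
  rw [huG, hvK, energy_eq_integral hΩ (memLp_smul_add_smul hup hvp _ _)
    (hG.smul_add_smul hb hp hK hGp hKp t (1 - t)) ((hGp.const_smul t).add (hKp.const_smul (1 - t))) hi]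
  norm_cast
  rw [← integral_const_mul, ← integral_const_mul, ← integral_add (hGi.const_mul _) (hKi.const_mul _)]
  exact integral_mono hi ((hGi.const_mul _).add (hKi.const_mul _)) fun x =>
    hjc.2 (mem_univ (G x)) (mem_univ (K x)) ht.le ht2.le (by ring)

end ImageRestoring

/-! ### Almost everywhere convergence from strict convexity -/

namespace ImageRestoring
open Filter Topology

section StrictlyConvexGap

variable {E : Type*} [NormedAddCommGroup E] [InnerProductSpace ℝ E]

/-- The midpoint convexity gap of the strictly convex function `√(1 + ‖·‖²)`. -/
noncomputable def midpointGap (a b : E) : ℝ :=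
  √(1 + ‖a‖ ^ 2) + √(1 + ‖b‖ ^ 2) - 2 * √(1 + ‖(1 / 2 : ℝ) • (a + b)‖ ^ 2)

/-- Squaring reduces the claim to `1 + ⟨a, b⟩ ≤ √(1 + ‖a‖²) √(1 + ‖b‖²)`, the Cauchy–Schwarz
inequality for `(1, a)` and `(1, b)`. The difference of the squares is at least `‖a - b‖²`, hence
strictness when `a ≠ b`. -/
theorem midpointGap_nonneg_and_pos (a b : E) :
    0 ≤ midpointGap a b ∧ (a ≠ b → 0 < midpointGap a b) := by
  set A := √(1 + ‖a‖ ^ 2) with hA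
  set B := √(1 + ‖b‖ ^ 2) with hB
  have hA2 : A ^ 2 = 1 + ‖a‖ ^ 2 := Real.sq_sqrt (by positivity)
  have hB2 : B ^ 2 = 1 + ‖b‖ ^ 2 := Real.sq_sqrt (by positivity)
  have hA0 : 0 ≤ A := Real.sqrt_nonneg _
  have hB0 : 0 ≤ B := Real.sqrt_nonneg _
  have hC : 2 * √(1 + ‖(1 / 2 : ℝ) • (a + b)‖ ^ 2) = √(4 + ‖a + b‖ ^ 2) := by
    rw [show (4 : ℝ) + ‖a + b‖ ^ 2 = 2 ^ 2 * (1 + ‖(1 / 2 : ℝ) • (a + b)‖ ^ 2) by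
      rw [norm_smul, mul_pow]; norm_num; ring, Real.sqrt_mul (by norm_num), Real.sqrt_sq (by norm_num)]
  have hcs : (inner ℝ a b) ^ 2 ≤ ‖a‖ ^ 2 * ‖b‖ ^ 2 := by
    rw [← mul_pow]
    exact sq_le_sq' (neg_le_of_abs_le (abs_real_inner_le_norm a b)) (real_inner_le_norm a b)
  have hsub := norm_sub_sq_real a b
  have hadd := norm_add_sq_real a b
  have hprod : (A * B) ^ 2 = (1 + ‖a‖ ^ 2) * (1 + ‖b‖ ^ 2) := by rw [mul_pow, hA2, hB2]
  have hle : 1 + inner ℝ a b ≤ A * B := by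
    refine le_of_abs_le (abs_le_of_sq_le_sq ?_ (mul_nonneg hA0 hB0))
    rw [hprod]
    nlinarith [sq_nonneg ‖a - b‖]
  constructor
  · rw [midpointGap, hC, sub_nonneg]
    refine Real.sqrt_le_iff.2 ⟨by positivity, ?_⟩
    nlinarith
  · intro hab
    have hpos : 0 < ‖a - b‖ ^ 2 := by
      have := norm_pos_iff.2 (sub_ne_zero.2 hab)
      positivity
    have hlt : 1 + inner ℝ a b < A * B := by
      refine lt_of_pow_lt_pow_left₀ 2 (mul_nonneg hA0 hB0) ?_
      rw [hprod]
      nlinarith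
    rw [midpointGap, hC, sub_pos]
    refine (Real.sqrt_lt' ?_).2 ?_
    · have : 1 ≤ A := by rw [hA]; exact Real.one_le_sqrt.2 (by nlinarith [sq_nonneg ‖a‖])
      linarith
    · nlinarith

theorem continuous_midpointGap : Continuous fun z : E × E => midpointGap z.1 z.2 := by
  unfold midpointGap
  fun_prop

/-- The gap is continuous and positive on the compact set of pairs in question, so it has a positive
minimum there. -/
theorem exists_le_midpointGap [ProperSpace E] (R : ℝ) {ε : ℝ} (hε : 0 < ε) :
    ∃ δ > 0, ∀ a b : E, ‖a‖ ≤ R → ‖b‖ ≤ R → ε ≤ ‖a - b‖ → δ ≤ midpointGap a b := by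
  set K : Set (E × E) := (Metric.closedBall 0 R ×ˢ Metric.closedBall 0 R) ∩ {z | ε ≤ ‖z.1 - z.2‖}
  have hK : IsCompact K := ((isCompact_closedBall _ _).prod (isCompact_closedBall _ _)).inter_right
    (isClosed_le continuous_const (by fun_prop))
  have hmem : ∀ a b : E, ‖a‖ ≤ R → ‖b‖ ≤ R → ε ≤ ‖a - b‖ → (a, b) ∈ K := by
    intro a b ha hb hab
    exact ⟨⟨by simpa using ha, by simpa using hb⟩, hab⟩
  rcases K.eq_empty_or_nonempty with h0 | hne
  · refine ⟨1, one_pos, fun a b ha hb hab => ?_⟩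
    have := hmem a b ha hb hab
    rw [h0] at this
    exact this.elim
  · obtain ⟨z, hz, hmin⟩ := hK.exists_isMinOn hne continuous_midpointGap.continuousOn
    refine ⟨midpointGap z.1 z.2, (midpointGap_nonneg_and_pos _ _).2 ?_, fun a b ha hb hab =>
      hmin (hmem a b ha hb hab)⟩
    intro h
    have : ε ≤ ‖z.1 - z.2‖ := hz.2
    rw [h, sub_self, norm_zero] at this
    linarith

end StrictlyConvexGap

section Compactness

variable {α : Type*} {m : MeasurableSpace α} {μ : Measure α} [IsFiniteMeasure μ]

/-- Borel–Cantelli along a subsequence with exceptional sets of measure at most `2⁻ⁱ`: almost every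
point eventually sees increments below `2⁻ⁱ`, which are summable. -/
theorem exists_subseq_tendsto_ae_of_cauchy_in_measure {E : Type*} [NormedAddCommGroup E]
    [CompleteSpace E] {f : ℕ → α → E}
    (h : ∀ ε > 0, ∃ N, ∀ n ≥ N, ∀ k ≥ n, μ.real {x | ε ≤ ‖f n x - f k x‖} ≤ ε) :
    ∃ φ : ℕ → ℕ, StrictMono φ ∧ ∃ g : α → E,
      ∀ᵐ x ∂μ, Tendsto (fun n => f (φ n) x) atTop (𝓝 (g x)) := by
  obtain ⟨φ, hφ, hP⟩ := extraction_forall_of_eventually'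
    (P := fun i n => ∀ k ≥ n, μ.real {x | (1 / 2 : ℝ) ^ i ≤ ‖f n x - f k x‖} ≤ (1 / 2 : ℝ) ^ i)
    (fun i => h _ (by positivity))
  have hsum : ∑' i, μ {x | (1 / 2 : ℝ) ^ i ≤ ‖f (φ i) x - f (φ (i + 1)) x‖} ≠ ⊤ := by
    refine ne_top_of_le_ne_top (b := ∑' i : ℕ, ENNReal.ofReal ((1 / 2 : ℝ) ^ i)) ?_ ?_
    · exact summable_geometric_two.tsum_ofReal_ne_top
    · refine ENNReal.tsum_le_tsum fun i => ?_
      rw [← ofReal_measureReal]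
      exact ENNReal.ofReal_le_ofReal (hP i _ (hφ.monotone (Nat.le_succ i)))
  have hae : ∀ᵐ x ∂μ, CauchySeq fun n => f (φ n) x := by
    filter_upwards [ae_eventually_notMem hsum] with x hx
    refine cauchySeq_of_summable_dist (Summable.of_norm_bounded_eventually_nat
      summable_geometric_two ?_)
    filter_upwards [hx] with i hi
    simp only [not_le] at hi
    rw [Real.norm_of_nonneg dist_nonneg, dist_eq_norm]
    exact hi.le
  classical
  refine ⟨φ, hφ, fun x => if hx : CauchySeq fun n => f (φ n) x then
    (cauchySeq_tendsto_of_complete hx).choose else 0, ?_⟩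
  filter_upwards [hae] with x hx
  rw [dif_pos hx]
  exact (cauchySeq_tendsto_of_complete hx).choose_spec

/-- From a decreasing sequence of midpoint-convex sets of functions, bounded in `L¹`, one may pick
a sequence that converges almost everywhere. -/
theorem exists_tendsto_ae_of_midpoint_convex {E : Type*} [NormedAddCommGroup E]
    [InnerProductSpace ℝ E] [ProperSpace E] {S : ℕ → Set (α → E)} (hanti : Antitone S)
    (hne : ∀ n, (S n).Nonempty)
    (hmid : ∀ n, ∀ f ∈ S n, ∀ g ∈ S n, (fun x => (1 / 2 : ℝ) • (f x + g x)) ∈ S n)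
    (hint : ∀ f ∈ S 0, Integrable f μ) {M : ℝ} (hM : ∀ f ∈ S 0, ∫ x, ‖f x‖ ∂μ ≤ M) :
    ∃ (F : ℕ → α → E) (g : α → E), (∀ n, F n ∈ S n) ∧
      ∀ᵐ x ∂μ, Tendsto (fun n => F n x) atTop (𝓝 (g x)) := by
  have hS0 : ∀ n, S n ⊆ S 0 := fun n => hanti (Nat.zero_le n)
  set I : (α → E) → ℝ := fun f => ∫ x, √(1 + ‖f x‖ ^ 2) ∂μ with hI
  have hsq : ∀ a : E, √(1 + ‖a‖ ^ 2) ≤ 1 + ‖a‖ := fun a =>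
    Real.sqrt_le_iff.2 ⟨by positivity, by nlinarith [norm_nonneg a]⟩
  have hIi : ∀ f ∈ S 0, Integrable (fun x => √(1 + ‖f x‖ ^ 2)) μ := by
    intro f hf
    refine ((integrable_const (1 : ℝ)).add (hint f hf).norm).mono' ?_
      (Eventually.of_forall fun x => ?_)
    · exact (by fun_prop : Continuous fun a : E => √(1 + ‖a‖ ^ 2)).comp_aestronglyMeasurable
        (hint f hf).1
    · rw [Real.norm_of_nonneg (Real.sqrt_nonneg _)]
      exact hsq _
  have hI0 : ∀ f, 0 ≤ I f := fun f => integral_nonneg fun x => Real.sqrt_nonneg _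
  have hIb : ∀ f ∈ S 0, I f ≤ μ.real univ + M := by
    intro f hf
    have h1 : I f ≤ ∫ x, (1 + ‖f x‖) ∂μ :=
      integral_mono (hIi f hf) ((integrable_const (1 : ℝ)).add (hint f hf).norm) fun x => hsq _
    rw [integral_add (integrable_const _) (hint f hf).norm] at h1
    have := hM f hf
    simp at h1
    linarith
  -- The infima increase with `n` and are bounded, so `L - c n → 0`. This is what makes
  -- near-minimizers from different `S n` comparable.
  set c : ℕ → ℝ := fun n => sInf (I '' S n) with hc
  have hbdd : ∀ n, BddBelow (I '' S n) := fun n => ⟨0, by rintro _ ⟨f, -, rfl⟩; exact hI0 f⟩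
  have hcm : Monotone c := fun n k hnk =>
    csInf_le_csInf (hbdd n) ((hne k).image I) (image_mono (hanti hnk))
  have hcb : BddAbove (range c) := by
    refine ⟨μ.real univ + M, ?_⟩
    rintro _ ⟨n, rfl⟩
    obtain ⟨f, hf⟩ := hne n
    exact (csInf_le (hbdd n) ⟨f, hf, rfl⟩).trans (hIb f (hS0 n hf))
  have hclim := tendsto_atTop_ciSup hcm hcb
  set L := ⨆ n, c n
  have hcL : ∀ n, c n ≤ L := le_ciSup hcb
  have hex : ∀ n : ℕ, ∃ f ∈ S n, I f < c n + 1 / ((n : ℝ) + 1) := by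
    intro n
    obtain ⟨_, ⟨f, hf, rfl⟩, h⟩ := exists_lt_of_csInf_lt ((hne n).image I)
      (lt_add_of_pos_right (c n) (Nat.one_div_pos_of_nat (n := n)))
    exact ⟨f, hf, h⟩
  choose f hfS hflt using hex
  have hgapi : ∀ n k, Integrable (fun x => midpointGap (f n x) (f k x)) μ := by
    intro n k
    exact ((hIi _ (hS0 n (hfS n))).add (hIi _ (hS0 k (hfS k)))).sub
      ((hIi _ (hmid 0 _ (hS0 n (hfS n)) _ (hS0 k (hfS k)))).const_mul 2)
  -- Both `f n` and `f k` lie in `S n`, hence so does their midpoint, whose integral is at least `c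
  -- n`; the gap integral is then bounded by the excesses over `c n`.
  have hgap : ∀ n k, n ≤ k →
      ∫ x, midpointGap (f n x) (f k x) ∂μ ≤ (L - c n) + 2 * (1 / ((n : ℝ) + 1)) := by
    intro n k hnk
    have e : ∫ x, midpointGap (f n x) (f k x) ∂μ
        = I (f n) + I (f k) - 2 * I (fun x => (1 / 2 : ℝ) • (f n x + f k x)) := by
      have i1 := hIi _ (hS0 n (hfS n))
      have i2 := hIi _ (hS0 k (hfS k))
      have i3 := hIi _ (hmid 0 _ (hS0 n (hfS n)) _ (hS0 k (hfS k)))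
      simp only [midpointGap, hI]
      rw [integral_sub (by exact i1.add i2) (i3.const_mul 2), integral_add i1 i2, integral_const_mul]
    have h1 : c n ≤ I (fun x => (1 / 2 : ℝ) • (f n x + f k x)) :=
      csInf_le (hbdd n) ⟨_, hmid n _ (hfS n) _ (hanti hnk (hfS k)), rfl⟩
    have h2 := hflt n
    have h3 := hflt k
    have h4 : 1 / ((k : ℝ) + 1) ≤ 1 / ((n : ℝ) + 1) := Nat.one_div_le_one_div hnk
    have h5 := hcL k
    rw [e]
    linarith
  have hη : Tendsto (fun n : ℕ => (L - c n) + 2 * (1 / ((n : ℝ) + 1))) atTop (𝓝 0) := by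
    have := (hclim.const_sub L).add ((tendsto_one_div_add_atTop_nhds_zero_nat (𝕜 := ℝ)).const_mul 2)
    simpa using this
  have hcauchy : ∀ ε > 0, ∃ N, ∀ n ≥ N, ∀ k ≥ n, μ.real {x | ε ≤ ‖f n x - f k x‖} ≤ ε := by
    intro ε hε
    have hM0 : 0 ≤ M := by
      obtain ⟨g, hg⟩ := hne 0
      exact (integral_nonneg fun x => norm_nonneg _).trans (hM g hg)
    -- Chosen so that Markov's inequality bounds each set `{R ≤ ‖f i‖}` by `ε / 3`; `M + 1` keeps
    -- `R` positive when `M = 0`.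
    set R : ℝ := 3 * (M + 1) / ε with hR
    have hRpos : 0 < R := by positivity
    obtain ⟨δ, hδ, hδgap⟩ := exists_le_midpointGap (E := E) R hε
    obtain ⟨N, hN⟩ := eventually_atTop.1 (hη.eventually_lt_const (show 0 < δ * ε / 3 by positivity))
    refine ⟨N, fun n hn k hk => ?_⟩
    have hsub : {x | ε ≤ ‖f n x - f k x‖} ⊆ ({x | R ≤ ‖f n x‖} ∪ {x | R ≤ ‖f k x‖}) ∪
        {x | δ ≤ midpointGap (f n x) (f k x)} := by
      intro x hx
      by_contra hcon
      simp only [mem_union, mem_ofPred_eq, not_or, not_le] at hcon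
      exact absurd (hδgap _ _ hcon.1.1.le hcon.1.2.le hx) (not_le.2 hcon.2)
    have hmark : ∀ i, μ.real {x | R ≤ ‖f i x‖} ≤ ε / 3 := by
      intro i
      have h1 := mul_meas_ge_le_integral_of_nonneg (Eventually.of_forall fun x => norm_nonneg (f i x))
        (hint _ (hS0 i (hfS i))).norm R
      have h2 : R * μ.real {x | R ≤ ‖f i x‖} ≤ R * (ε / 3) := by
        refine (h1.trans (hM _ (hS0 i (hfS i)))).trans ?_
        rw [hR]
        field_simp
        linarith
      exact le_of_mul_le_mul_left h2 hRpos
    have hmark2 : μ.real {x | δ ≤ midpointGap (f n x) (f k x)} ≤ ε / 3 := by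
      have h1 := mul_meas_ge_le_integral_of_nonneg
        (Eventually.of_forall fun x => (midpointGap_nonneg_and_pos (f n x) (f k x)).1) (hgapi n k) δ
      have h2 := hN n hn
      have h3 := hgap n k hk
      refine le_of_mul_le_mul_left ?_ hδ
      linarith
    calc μ.real {x | ε ≤ ‖f n x - f k x‖} ≤ _ := measureReal_mono hsub
      _ ≤ _ := measureReal_union_le _ _
      _ ≤ _ := add_le_add_left (measureReal_union_le _ _) _
      _ ≤ ε := by linarith [hmark n, hmark k]
  obtain ⟨φ, hφ, g, hg⟩ := exists_subseq_tendsto_ae_of_cauchy_in_measure hcauchy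
  exact ⟨fun n => f (φ n), g, fun n => hanti (hφ.id_le n) (hfS (φ n)), hg⟩

end Compactness

end ImageRestoring

/-! ### Lower semicontinuity of the energy -/

namespace ImageRestoring
open Filter Topology

variable {d : ℕ} {Ω : Set (Rd d)} {j : Rd d → ℝ} {p : ℝ}

section General

variable {α : Type*} {m : MeasurableSpace α} {μ : Measure α}
  {E : Type*} [NormedAddCommGroup E]

/-- Bounded sequences in `L^p`, `p > 1`, are uniformly integrable. -/
theorem unifIntegrable_one_of_eLpNorm_le {ι : Type*} (hp : 1 < p) {F : ι → α → E}
    (hF : ∀ n, AEStronglyMeasurable (F n) μ) {b : ℝ}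
    (hb : ∀ n, eLpNorm (F n) (ENNReal.ofReal p) μ ≤ ENNReal.ofReal b) :
    UnifIntegrable F 1 μ := by
  intro ε hε
  have hp0 : 0 < p := by linarith
  set a : ℝ := 1 - 1 / p with ha
  have ha0 : 0 < a := by
    rw [ha, sub_pos, div_lt_one hp0]
    exact hp
  set b' : ℝ := max b 1
  have hb' : 0 < b' := lt_max_of_lt_right one_pos
  -- Hölder bounds the `L¹` norm on `s` by `b' (μ s)^a` with `a = 1 - 1/p > 0`; this threshold makes
  -- the bound equal to `ε`.
  refine ⟨(ε / b') ^ (1 / a), by positivity, fun n s hs hμs => ?_⟩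
  rw [eLpNorm_indicator_eq_eLpNorm_restrict hs]
  refine (eLpNorm_le_eLpNorm_mul_rpow_measure_univ (q := ENNReal.ofReal p) ?_ (hF n).restrict).trans ?_
  · rw [← ENNReal.ofReal_one]; exact ENNReal.ofReal_le_ofReal hp.le
  rw [Measure.restrict_apply_univ, ENNReal.toReal_ofReal hp0.le, ENNReal.toReal_one, div_one]
  have h1 : eLpNorm (F n) (ENNReal.ofReal p) (μ.restrict s) ≤ ENNReal.ofReal b' :=
    (eLpNorm_restrict_le _ _ _ _).trans ((hb n).trans (ENNReal.ofReal_le_ofReal (le_max_left _ _)))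
  have h2 : μ s ^ a ≤ ENNReal.ofReal (ε / b') := by
    refine (ENNReal.rpow_le_rpow hμs ha0.le).trans (le_of_eq ?_)
    rw [ENNReal.ofReal_rpow_of_nonneg (by positivity) ha0.le, ← Real.rpow_mul (by positivity),
      one_div_mul_cancel ha0.ne', Real.rpow_one]
  refine (mul_le_mul' h1 h2).trans (le_of_eq ?_)
  rw [← ENNReal.ofReal_mul hb'.le]
  congr 1
  field_simp

theorem eLpNorm_le_of_integral_norm_rpow_le (hp : 1 < p) {f : α → E}
    (hf : MemLp f (ENNReal.ofReal p) μ) {B : ℝ} (hB : ∫ x, ‖f x‖ ^ p ∂μ ≤ B) :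
    eLpNorm f (ENNReal.ofReal p) μ ≤ ENNReal.ofReal (B ^ (1 / p)) := by
  have hp0 : 0 < p := by linarith
  rw [hf.eLpNorm_eq_integral_rpow_norm (by simpa using hp0) (by simp),
    ENNReal.toReal_ofReal hp0.le, ← one_div]
  refine ENNReal.ofReal_le_ofReal (Real.rpow_le_rpow ?_ hB (by positivity))
  exact integral_nonneg fun x => by positivity

theorem memLp_of_tendsto_ae_of_eLpNorm_le {q : ℝ≥0∞} {F : ℕ → α → E} {g : α → E}
    (hF : ∀ n, AEStronglyMeasurable (F n) μ)
    (hg : ∀ᵐ x ∂μ, Tendsto (fun n => F n x) atTop (𝓝 (g x))) {b : ℝ≥0∞} (hb : b ≠ ⊤)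
    (hle : ∀ n, eLpNorm (F n) q μ ≤ b) : MemLp g q μ := by
  refine ⟨aestronglyMeasurable_of_tendsto_ae _ hF hg, lt_of_le_of_lt ?_ hb.lt_top⟩
  refine (Lp.eLpNorm_lim_le_liminf_eLpNorm hF g hg).trans ?_
  exact liminf_le_of_frequently_le' (Eventually.of_forall hle).frequently

/-- Fatou's lemma for a sequence of real functions bounded below by a constant. -/
theorem integral_le_of_tendsto_ae_of_le [IsFiniteMeasure μ] {F : ℕ → α → ℝ} {g : α → ℝ} {a c : ℝ}
    (hF : ∀ n, Integrable (F n) μ) (hgi : Integrable g μ)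
    (hg : ∀ᵐ x ∂μ, Tendsto (fun n => F n x) atTop (𝓝 (g x)))
    (ha : ∀ n x, a ≤ F n x) (hag : ∀ x, a ≤ g x) (hc : ∀ n, ∫ x, F n x ∂μ ≤ c) :
    ∫ x, g x ∂μ ≤ c := by
  have hsub : ∀ f : α → ℝ, Integrable f μ → (∀ x, a ≤ f x) →
      ∫⁻ x, ENNReal.ofReal (f x - a) ∂μ = ENNReal.ofReal (∫ x, f x ∂μ - a * μ.real univ) := by
    intro f hf hfa
    rw [← ofReal_integral_eq_lintegral_ofReal (by exact hf.sub (integrable_const a))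
      (Eventually.of_forall fun x => sub_nonneg.2 (hfa x)),
      integral_sub hf (integrable_const a)]
    simp [mul_comm]
  have hK : 0 ≤ c - a * μ.real univ := by
    have h1 : ∫ _, a ∂μ ≤ ∫ x, F 0 x ∂μ := integral_mono (integrable_const a) (hF 0) (ha 0)
    have h2 := hc 0
    simp [mul_comm] at h1
    linarith
  have key : ∫⁻ x, ENNReal.ofReal (g x - a) ∂μ ≤ ENNReal.ofReal (c - a * μ.real univ) := by
    calc ∫⁻ x, ENNReal.ofReal (g x - a) ∂μ
        = ∫⁻ x, liminf (fun n => ENNReal.ofReal (F n x - a)) atTop ∂μ := by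
          refine lintegral_congr_ae ?_
          filter_upwards [hg] with x hx
          exact ((ENNReal.tendsto_ofReal (hx.sub_const a)).liminf_eq).symm
      _ ≤ liminf (fun n => ∫⁻ x, ENNReal.ofReal (F n x - a) ∂μ) atTop :=
          lintegral_liminf_le' fun n =>
            ((hF n).aestronglyMeasurable.aemeasurable.sub_const a).ennreal_ofReal
      _ ≤ _ := by
          refine liminf_le_of_frequently_le' (Eventually.of_forall fun n => ?_).frequently
          rw [hsub _ (hF n) (ha n)]
          exact ENNReal.ofReal_le_ofReal (by linarith [hc n])
  rw [hsub g hgi hag, ENNReal.ofReal_le_ofReal_iff hK] at key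
  linarith

end General

/-- The distributional gradient is closed under `L¹` convergence. -/
theorem HasWeakGradient.of_tendsto (hb : Bornology.IsBounded Ω) {v : ℕ → Rd d → ℝ}
    {F : ℕ → Rd d → Rd d} {u : Rd d → ℝ} {g : Rd d → Rd d} (h : ∀ n, HasWeakGradient Ω (v n) (F n))
    (hv : ∀ n, IntegrableOn (v n) Ω) (hF : ∀ n, IntegrableOn (F n) Ω)
    (hu : IntegrableOn u Ω) (hg : IntegrableOn g Ω)
    (hvu : Tendsto (fun n => eLpNorm (fun x => v n x - u x) 1 (volume.restrict Ω)) atTop (𝓝 0))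
    (hFg : Tendsto (fun n => eLpNorm (fun x => F n x - g x) 1 (volume.restrict Ω)) atTop (𝓝 0)) :
    HasWeakGradient Ω u g := by
  have := isFiniteMeasure_restrict_of_isBounded hb
  refine hasWeakGradient_of_integrableOn hu hg fun ψ hψ i => ?_
  have m1 : MemLp (fun x => gradient ψ x i) ⊤ (volume.restrict Ω) := by
    obtain ⟨C, hC⟩ := hψ.exists_bound_gradient
    exact memLp_top_of_bound
      ((continuous_coord i).comp (ContDiff.continuous_gradient hψ.1)).aestronglyMeasurable C
      (Eventually.of_forall fun x => (abs_apply_le_norm _ i).trans (hC x))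
  -- The integrand `Kᵢ ψ` is the inner product of `K` with `ψ eᵢ`, so both sides of the identity
  -- pass to the limit by `L^∞`–`L¹` duality.
  have m2 : MemLp (fun x => ψ x • EuclideanSpace.single i (1 : ℝ)) ⊤ (volume.restrict Ω) := by
    obtain ⟨C, hC⟩ := hψ.exists_bound
    refine memLp_top_of_bound (hψ.1.continuous.smul continuous_const).aestronglyMeasurable C
      (Eventually.of_forall fun x => ?_)
    rw [norm_smul]
    simpa using hC x
  have t1 := tendsto_integral_inner_of_tendsto_eLpNorm m1
    (fun n => memLp_one_iff_integrable.2 (hv n)) (memLp_one_iff_integrable.2 hu) hvu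
  have t2 := tendsto_integral_inner_of_tendsto_eLpNorm m2
    (fun n => memLp_one_iff_integrable.2 (hF n)) (memLp_one_iff_integrable.2 hg) hFg
  have e1 : ∀ w : Rd d → ℝ, ∫ x in Ω, inner ℝ (gradient ψ x i) (w x) =
      ∫ x in Ω, w x * gradient ψ x i := fun w => rfl
  have e2 : ∀ K : Rd d → Rd d, ∫ x in Ω, inner ℝ (ψ x • EuclideanSpace.single i (1 : ℝ)) (K x) =
      ∫ x in Ω, K x i * ψ x := by
    intro K
    refine integral_congr_ae (Eventually.of_forall fun x => ?_)
    simp only [inner_smul_left, EuclideanSpace.inner_single_left]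
    simp [mul_comm]
  simp only [e1] at t1
  simp only [e2] at t2
  simp only [(h _).2.2 ψ hψ i] at t1
  exact tendsto_nhds_unique t1 t2.neg

/-- Convexity of the sublevel set replaces weak compactness: `exists_tendsto_ae_of_midpoint_convex`
selects functions tending to `u` in `L²` whose gradients converge almost everywhere. Uniform
integrability identifies the limit with `∇u`, and Fatou's lemma gives the energy bound. The
hypothesis `hreg` supplies `u ∈ L^p`, which the selection does not control. -/
theorem isClosed_energy_le (hΩ : IsOpen Ω) (hb : Bornology.IsBounded Ω) (hp : 1 < p)
    (hjc : ConvexOn ℝ univ j) (hjm : Continuous j) {ω₁ ω₂ C₁ C₂ : ℝ} (hω₁ : 0 < ω₁)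
    (hj : ∀ r : Rd d, ω₁ * ‖r‖ ^ p + C₁ ≤ j r ∧ j r ≤ ω₂ * ‖r‖ ^ p + C₂)
    (hreg : ∀ (u : L2 Ω) (G : Rd d → Rd d), HasWeakGradient Ω u G →
      MemLp G (ENNReal.ofReal p) (volume.restrict Ω) →
      MemLp u (ENNReal.ofReal p) (volume.restrict Ω)) (c : ℝ) :
    IsClosed {u : L2 Ω | energy Ω p j u ≤ c} := by
  have := isFiniteMeasure_restrict_of_isBounded hb
  have hint : ∀ G : Rd d → Rd d, MemLp G (ENNReal.ofReal p) (volume.restrict Ω) →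
      Integrable (fun x => j (G x)) (volume.restrict Ω) :=
    fun G hG => integrable_comp_of_growth hjm hp hj hG
  have hconv := isConvexFunctional_energy hΩ hb hp hjc hint
  refine isClosed_of_closure_subset fun u hu => ?_
  set S : ℕ → Set (Rd d → Rd d) := fun n => {G | ∃ v : L2 Ω, HasWeakGradient Ω v G ∧
    MemLp G (ENNReal.ofReal p) (volume.restrict Ω) ∧ ∫ x in Ω, j (G x) ≤ c ∧
    ‖v - u‖ ≤ 1 / ((n : ℝ) + 1)} with hS
  have hanti : Antitone S := by
    rintro n k hnk G ⟨v, h1, h2, h3, h4⟩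
    exact ⟨v, h1, h2, h3, h4.trans (Nat.one_div_le_one_div hnk)⟩
  have hne : ∀ n, (S n).Nonempty := by
    intro n
    obtain ⟨v, hv, hvu⟩ := Metric.mem_closure_iff.1 hu _ (Nat.one_div_pos_of_nat (n := n))
    obtain ⟨G, -, hG, hGp, -, he⟩ := energy_ne_top hΩ (ne_top_of_le_ne_top (EReal.coe_ne_top _) hv)
    change energy Ω p j v ≤ c at hv
    rw [he] at hv
    refine ⟨G, v, hG, hGp, by exact_mod_cast hv, ?_⟩
    rw [dist_comm, dist_eq_norm] at hvu
    exact hvu.le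
  have hmid : ∀ n, ∀ f ∈ S n, ∀ g ∈ S n, (fun x => (1 / 2 : ℝ) • (f x + g x)) ∈ S n := by
    rintro n f ⟨v, h1, h2, h3, h4⟩ g ⟨w, k1, k2, k3, k4⟩
    simp only [smul_add]
    have hp' := (h2.const_smul (1 / 2 : ℝ)).add (k2.const_smul (1 / 2 : ℝ))
    refine ⟨(1 / 2 : ℝ) • v + (1 / 2 : ℝ) • w, h1.smul_add_smul hb hp k1 h2 k2 _ _, hp', ?_, ?_⟩
    · have hle : ∫ x in Ω, j ((1 / 2 : ℝ) • f x + (1 / 2 : ℝ) • g x)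
          ≤ ∫ x in Ω, ((1 / 2 : ℝ) * j (f x) + (1 / 2 : ℝ) * j (g x)) :=
        integral_mono (hint _ hp') (((hint _ h2).const_mul _).add ((hint _ k2).const_mul _))
          fun x => hjc.2 (mem_univ (f x)) (mem_univ (g x)) (by norm_num) (by norm_num) (by norm_num)
      rw [integral_add ((hint _ h2).const_mul _) ((hint _ k2).const_mul _), integral_const_mul,
        integral_const_mul] at hle
      linarith
    · have e : (1 / 2 : ℝ) • v + (1 / 2 : ℝ) • w - u = (1 / 2 : ℝ) • (v - u) + (1 / 2 : ℝ) • (w - u) := by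
        module
      rw [e]
      refine (norm_add_le _ _).trans ?_
      rw [norm_smul, norm_smul]
      norm_num at h4 k4 ⊢
      linarith
  set V := (volume.restrict Ω).real univ
  -- The bound on `∫ ‖G‖^p` obtained by integrating the lower growth bound over a gradient of energy
  -- at most `c`.
  set B : ℝ := (c - C₁ * V) / ω₁ with hB
  have hBle : ∀ n, ∀ G ∈ S n, ∫ x in Ω, ‖G x‖ ^ p ≤ B := by
    rintro n G ⟨v, h1, h2, h3, h4⟩
    have hi := integrable_norm_rpow_of_memLp hp h2
    have hle : ∫ x in Ω, (ω₁ * ‖G x‖ ^ p + C₁) ≤ ∫ x in Ω, j (G x) :=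
      integral_mono ((hi.const_mul _).add (integrable_const _)) (hint _ h2) fun x => (hj (G x)).1
    rw [integral_add (hi.const_mul _) (integrable_const _), integral_const_mul, integral_const,
      smul_eq_mul] at hle
    rw [hB, le_div_iff₀ hω₁]
    linarith
  have hSm : ∀ n, ∀ G ∈ S n, MemLp G (ENNReal.ofReal p) (volume.restrict Ω) :=
    fun n G ⟨v, h1, h2, h3, h4⟩ => h2
  obtain ⟨F, g, hFS, hFg⟩ := exists_tendsto_ae_of_midpoint_convex (μ := volume.restrict Ω) hanti hne hmid
    (fun G hG => integrableOn_of_memLp hb (one_le_ofReal hp) (hSm 0 G hG)) (M := V + B) (by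
      intro G hG
      have hi := integrable_norm_rpow_of_memLp hp (hSm 0 G hG)
      have hle : ∫ x in Ω, ‖G x‖ ≤ ∫ x in Ω, (1 + ‖G x‖ ^ p) := by
        refine integral_mono (integrableOn_of_memLp hb (one_le_ofReal hp) (hSm 0 G hG)).norm
          ((integrable_const _).add hi) fun x => ?_
        rcases le_total ‖G x‖ 1 with h | h
        · have : 0 ≤ ‖G x‖ ^ p := by positivity
          linarith
        · have := Real.self_le_rpow_of_one_le h hp.le
          linarith
      rw [integral_add (integrable_const _) hi, integral_const, smul_eq_mul, mul_one] at hle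
      linarith [hBle 0 G hG])
  choose v hv1 hv2 hv3 hv4 using hFS
  have hbd : ∀ n, eLpNorm (F n) (ENNReal.ofReal p) (volume.restrict Ω)
      ≤ ENNReal.ofReal (B ^ (1 / p)) := fun n =>
    eLpNorm_le_of_integral_norm_rpow_le hp (hv2 n) (hBle n _ ⟨v n, hv1 n, hv2 n, hv3 n, hv4 n⟩)
  have hgp : MemLp g (ENNReal.ofReal p) (volume.restrict Ω) :=
    memLp_of_tendsto_ae_of_eLpNorm_le (fun n => (hv2 n).1) hFg ENNReal.ofReal_ne_top hbd
  have hg1 := integrableOn_of_memLp hb (one_le_ofReal hp) hgp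
  -- Vitali's theorem; the assumption `p > 1` enters through uniform integrability.
  have hFg1 := tendsto_Lp_finite_of_tendsto_ae le_rfl ENNReal.one_ne_top (fun n => (hv2 n).1)
    (memLp_one_iff_integrable.2 hg1) (unifIntegrable_one_of_eLpNorm_le hp (fun n => (hv2 n).1) hbd) hFg
  have hvu : Tendsto (fun n => eLpNorm (fun x => v n x - u x) 1 (volume.restrict Ω)) atTop (𝓝 0) := by
    have h1 : Tendsto v atTop (𝓝 u) := by
      rw [tendsto_iff_norm_sub_tendsto_zero]
      exact squeeze_zero (fun _ => norm_nonneg _) hv4 tendsto_one_div_add_atTop_nhds_zero_nat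
    have h2 := (Lp.tendsto_Lp_iff_tendsto_eLpNorm' v u).1 h1
    have h3 := ENNReal.Tendsto.mul_const (b := (volume.restrict Ω) univ ^
      (1 / (1 : ℝ≥0∞).toReal - 1 / (2 : ℝ≥0∞).toReal)) h2 (Or.inr (by
        refine ENNReal.rpow_ne_top_of_nonneg (by norm_num) (measure_ne_top _ _)))
    rw [zero_mul] at h3
    refine tendsto_of_tendsto_of_tendsto_of_le_of_le tendsto_const_nhds h3 (fun _ => zero_le) fun n => ?_
    exact eLpNorm_le_eLpNorm_mul_rpow_measure_univ (by norm_num)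
      ((Lp.aestronglyMeasurable _).sub (Lp.aestronglyMeasurable _))
  have hug : HasWeakGradient Ω u g := HasWeakGradient.of_tendsto hb hv1
    (fun n => L2.integrableOn hb _) (fun n => integrableOn_of_memLp hb (one_le_ofReal hp) (hv2 n))
    (L2.integrableOn hb _) hg1 hvu hFg1
  change energy Ω p j u ≤ c
  rw [energy_eq_integral hΩ (hreg u g hug hgp) hug hgp (hint g hgp)]
  norm_cast
  have hlow : ∀ r, C₁ ≤ j r := fun r => by
    have := (hj r).1
    have : 0 ≤ ω₁ * ‖r‖ ^ p := by positivity
    linarith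
  refine integral_le_of_tendsto_ae_of_le (fun n => hint _ (hv2 n)) (hint g hgp) ?_
    (fun n x => hlow _) (fun x => hlow _) hv3
  filter_upwards [hFg] with x hx
  exact (hjm.tendsto _).comp hx

theorem lowerSemicontinuous_energy (hΩ : IsOpen Ω) (hb : Bornology.IsBounded Ω) (hp : 1 < p)
    (hjc : ConvexOn ℝ univ j) (hjm : Continuous j) {ω₁ ω₂ C₁ C₂ : ℝ} (hω₁ : 0 < ω₁)
    (hj : ∀ r : Rd d, ω₁ * ‖r‖ ^ p + C₁ ≤ j r ∧ j r ≤ ω₂ * ‖r‖ ^ p + C₂)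
    (hreg : ∀ (u : L2 Ω) (G : Rd d → Rd d), HasWeakGradient Ω u G →
      MemLp G (ENNReal.ofReal p) (volume.restrict Ω) →
      MemLp u (ENNReal.ofReal p) (volume.restrict Ω)) :
    LowerSemicontinuous (energy Ω p j) := by
  rw [lowerSemicontinuous_iff_isClosed_preimage]
  intro c
  induction c with
  | bot =>
    convert! isClosed_empty
    ext u
    simpa using energy_ne_bot u
  | coe c => exact isClosed_energy_le hΩ hb hp hjc hjm hω₁ hj hreg c
  | top => simp

end ImageRestoring

/-! ### Mollification with off-centre kernels -/

namespace ImageRestoring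
open Filter Topology

section Jensen

variable {α β : Type*} {mα : MeasurableSpace α} {mβ : MeasurableSpace β}

theorem lintegral_rpow_le_lintegral_rpow {ν : Measure β} [IsProbabilityMeasure ν] {q : ℝ}
    (hq : 1 ≤ q) {f : β → ℝ≥0∞} (hf : AEMeasurable f ν) :
    (∫⁻ y, f y ∂ν) ^ q ≤ ∫⁻ y, f y ^ q ∂ν := by
  have hq0 : 0 < q := by linarith
  have h := eLpNorm'_le_eLpNorm'_of_exponent_le one_pos hq ν hf.aestronglyMeasurable
  simp only [eLpNorm', ENNReal.rpow_one, enorm_eq_self, one_div, inv_one] at h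
  calc (∫⁻ y, f y ∂ν) ^ q ≤ ((∫⁻ y, f y ^ q ∂ν) ^ q⁻¹) ^ q := ENNReal.rpow_le_rpow h hq0.le
    _ = _ := by rw [← ENNReal.rpow_mul, inv_mul_cancel₀ hq0.ne', ENNReal.rpow_one]

/-- Jensen's inequality followed by Tonelli. Every `L^q` bound on an average of translates below
rests on it. -/
theorem lintegral_rpow_lintegral_le {μ : Measure α} [SFinite μ] {ν : Measure β}
    [IsProbabilityMeasure ν] {q : ℝ} (hq : 1 ≤ q) {F : α → β → ℝ≥0∞}
    (hF : AEMeasurable (Function.uncurry F) (μ.prod ν)) :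
    ∫⁻ x, (∫⁻ y, F x y ∂ν) ^ q ∂μ ≤ ∫⁻ y, ∫⁻ x, F x y ^ q ∂μ ∂ν := by
  rw [← lintegral_lintegral_swap (f := fun x y => F x y ^ q) (hF.pow_const q)]
  refine lintegral_mono_ae ?_
  filter_upwards [hF.aestronglyMeasurable.prodMk_left] with x hx
  exact lintegral_rpow_le_lintegral_rpow hq hx.aemeasurable

theorem eLpNorm_ofReal_rpow {E : Type*} [NormedAddCommGroup E] {μ : Measure α} {q : ℝ}
    (hq : 0 < q) (f : α → E) :
    eLpNorm f (ENNReal.ofReal q) μ ^ q = ∫⁻ x, ‖f x‖ₑ ^ q ∂μ := by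
  rw [eLpNorm_eq_lintegral_rpow_enorm_toReal (by simpa using hq) (by simp), ENNReal.toReal_ofReal hq.le,
    ← ENNReal.rpow_mul, one_div_mul_cancel hq.ne', ENNReal.rpow_one]

theorem eLpNorm_ofReal_le_of_rpow_le {E : Type*} [NormedAddCommGroup E] {μ : Measure α} {q : ℝ}
    (hq : 0 < q) {f : α → E} {c : ℝ≥0∞} (h : ∫⁻ x, ‖f x‖ₑ ^ q ∂μ ≤ c ^ q) :
    eLpNorm f (ENNReal.ofReal q) μ ≤ c := by
  rw [← eLpNorm_ofReal_rpow hq] at h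
  exact (ENNReal.rpow_le_rpow_iff hq).1 h

end Jensen

variable {d : ℕ} {Ω : Set (Rd d)} {E : Type*} [NormedAddCommGroup E]

/-- Continuity of translation in `L^q`, as an instance of the continuity in `Lp` of composition with
measure-preserving maps. -/
theorem exists_eLpNorm_translate_sub_le {q : ℝ} (hq : 1 ≤ q) {f : Rd d → E}
    (hf : MemLp f (ENNReal.ofReal q) volume) {ε : ℝ≥0∞} (hε : 0 < ε) :
    ∃ δ > 0, ∀ y : Rd d, ‖y‖ < δ →
      eLpNorm (fun x => f (x - y) - f x) (ENNReal.ofReal q) volume ≤ ε := by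
  have : Fact (1 ≤ ENNReal.ofReal q) := ⟨by
    rw [← ENNReal.ofReal_one]; exact ENNReal.ofReal_le_ofReal hq⟩
  let g : C(Rd d, C(Rd d, Rd d)) := ContinuousMap.curry ⟨fun z : Rd d × Rd d => z.2 - z.1, by fun_prop⟩
  have hgm : ∀ y, MeasurePreserving (g y) volume volume := fun y =>
    measurePreserving_sub_right volume y
  have hc : Continuous fun y => Lp.compMeasurePreserving (g y) (hgm y) (hf.toLp f) :=
    continuous_const.compMeasurePreservingLp g.continuous hgm ENNReal.ofReal_ne_top
  have ht := (hc.tendsto 0)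
  have h2 := EMetric.tendsto_nhds.1 ht ε hε
  obtain ⟨δ, hδ, hball⟩ := Metric.eventually_nhds_iff.1 h2
  refine ⟨δ, hδ, fun y hy => ?_⟩
  have h3 := (hball (by simpa using hy : dist y 0 < δ)).le
  rw [Lp.toLp_compMeasurePreserving, Lp.toLp_compMeasurePreserving, Lp.edist_toLp_toLp] at h3
  refine le_trans (le_of_eq ?_) h3
  congr 1
  ext x
  simp [g]

/-! ### Mollification -/

/-- `k` is a smooth probability density supported in the ball of center `c` and radius `r`. -/
structure IsMollifier (k : Rd d → ℝ) (c : Rd d) (r : ℝ) : Prop where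
  contDiff : ContDiff ℝ ∞ k
  nonneg : ∀ y, 0 ≤ k y
  integral_eq_one : ∫ y, k y = 1
  norm_sub_lt : ∀ y, k y ≠ 0 → ‖y - c‖ < r

theorem exists_isMollifier (c : Rd d) {r : ℝ} (hr : 0 < r) : ∃ k, IsMollifier k c r := by
  let b : ContDiffBump c := ⟨r / 2, r, by positivity, by linarith⟩
  refine ⟨b.normed volume, b.contDiff_normed, b.nonneg_normed, b.integral_normed, fun y hy => ?_⟩
  have : y ∈ Function.support (b.normed volume) := hy
  rw [b.support_normed_eq] at this
  simpa [dist_eq_norm] using this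

/-- The convolution of `f` with the kernel `k`. -/
noncomputable def mollify [NormedSpace ℝ E] (k : Rd d → ℝ) (f : Rd d → E) (x : Rd d) : E :=
  ∫ y, k (x - y) • f y

theorem mollify_eq_integral_translate [NormedSpace ℝ E] (k : Rd d → ℝ) (f : Rd d → E) (x : Rd d) :
    mollify k f x = ∫ y, k y • f (x - y) := by
  rw [mollify, ← integral_sub_left_eq_self (fun y => k y • f (x - y)) volume x]
  simp

namespace IsMollifier

variable {k : Rd d → ℝ} {c : Rd d} {r : ℝ}

theorem support_subset (hk : IsMollifier k c r) : Function.support k ⊆ Metric.closedBall c r :=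
  fun y hy => by
    rw [mem_closedBall_iff_norm]
    exact (hk.norm_sub_lt y hy).le

theorem hasCompactSupport (hk : IsMollifier k c r) : HasCompactSupport k :=
  HasCompactSupport.of_support_subset_isCompact (isCompact_closedBall _ _) hk.support_subset

theorem integrable (hk : IsMollifier k c r) : Integrable k :=
  hk.contDiff.continuous.integrable_of_hasCompactSupport hk.hasCompactSupport

/-- The probability measure of density `k`. -/
noncomputable def measure (_ : IsMollifier k c r) : Measure (Rd d) :=
  volume.withDensity fun y => ENNReal.ofReal (k y)

theorem isProbabilityMeasure (hk : IsMollifier k c r) : IsProbabilityMeasure hk.measure := by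
  constructor
  rw [measure, withDensity_apply _ MeasurableSet.univ, Measure.restrict_univ,
    ← ofReal_integral_eq_lintegral_ofReal hk.integrable (Eventually.of_forall hk.nonneg),
    hk.integral_eq_one, ENNReal.ofReal_one]

theorem ae_norm_sub_lt (hk : IsMollifier k c r) : ∀ᵐ y ∂hk.measure, ‖y - c‖ < r := by
  rw [measure, ae_withDensity_iff hk.contDiff.continuous.measurable.ennreal_ofReal]
  refine Eventually.of_forall fun y hy => hk.norm_sub_lt y ?_
  intro h0
  simp [h0] at hy

theorem aemeasurable_translate (hk : IsMollifier k c r) {f : Rd d → E}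
    (hf : AEStronglyMeasurable f volume) :
    AEStronglyMeasurable (fun z : Rd d × Rd d => f (z.1 - z.2)) (volume.prod hk.measure) := by
  have := hk.isProbabilityMeasure
  exact hf.comp_quasiMeasurePreserving (quasiMeasurePreserving_sub_of_right_invariant _ _)

variable [NormedSpace ℝ E]

theorem integral_measure (hk : IsMollifier k c r) (g : Rd d → E) :
    ∫ y, g y ∂hk.measure = ∫ y, k y • g y := by
  rw [measure, integral_withDensity_eq_integral_toReal_smul
    hk.contDiff.continuous.measurable.ennreal_ofReal (Eventually.of_forall fun _ => ENNReal.ofReal_lt_top)]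
  refine integral_congr_ae (Eventually.of_forall fun y => ?_)
  simp only [ENNReal.toReal_ofReal (hk.nonneg y)]

theorem integrable_smul (hk : IsMollifier k c r) {f : Rd d → E} (hf : LocallyIntegrable f)
    (x : Rd d) : Integrable fun y => k (x - y) • f y := by
  refine hf.integrable_smul_left_of_hasCompactSupport (hk.contDiff.continuous.comp (by fun_prop)) ?_
  exact hk.hasCompactSupport.comp_homeomorph (Homeomorph.subLeft x)

theorem integrable_smul_translate (hk : IsMollifier k c r) {f : Rd d → E}
    (hf : LocallyIntegrable f) (x : Rd d) : Integrable fun y => k y • f (x - y) := by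
  have := (hk.integrable_smul hf x).comp_sub_left x
  simpa using this

variable [CompleteSpace E]

theorem mollify_sub_eq (hk : IsMollifier k c r) {f : Rd d → E} (hf : LocallyIntegrable f)
    (x : Rd d) (a : E) : mollify k f x - a = ∫ y, (f (x - y) - a) ∂hk.measure := by
  rw [mollify_eq_integral_translate, hk.integral_measure]
  simp only [smul_sub]
  rw [integral_sub (hk.integrable_smul_translate hf x) (hk.integrable.smul_const a),
    integral_smul_const, hk.integral_eq_one, one_smul]

theorem enorm_mollify_sub_le (hk : IsMollifier k c r) {f : Rd d → E} (hf : LocallyIntegrable f)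
    (x : Rd d) (a : E) : ‖mollify k f x - a‖ₑ ≤ ∫⁻ y, ‖f (x - y) - a‖ₑ ∂hk.measure := by
  rw [hk.mollify_sub_eq hf]
  exact enorm_integral_le_lintegral_enorm _

/-- Young's inequality for a probability density. -/
theorem eLpNorm_mollify_le (hk : IsMollifier k c r) {q : ℝ} (hq : 1 ≤ q) {f : Rd d → E}
    (hf : LocallyIntegrable f) :
    eLpNorm (mollify k f) (ENNReal.ofReal q) volume ≤ eLpNorm f (ENNReal.ofReal q) volume := by
  have := hk.isProbabilityMeasure
  have hq0 : 0 < q := by linarith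
  refine eLpNorm_ofReal_le_of_rpow_le hq0 ?_
  calc ∫⁻ x, ‖mollify k f x‖ₑ ^ q ≤ ∫⁻ x, (∫⁻ y, ‖f (x - y)‖ₑ ∂hk.measure) ^ q := by
        refine lintegral_mono fun x => ENNReal.rpow_le_rpow ?_ hq0.le
        simpa using hk.enorm_mollify_sub_le hf x 0
    _ ≤ ∫⁻ y, (∫⁻ x, ‖f (x - y)‖ₑ ^ q) ∂hk.measure :=
        lintegral_rpow_lintegral_le hq (hk.aemeasurable_translate hf.aestronglyMeasurable).enorm
    _ = ∫⁻ _, eLpNorm f (ENNReal.ofReal q) volume ^ q ∂hk.measure := by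
        refine lintegral_congr fun y => ?_
        rw [eLpNorm_ofReal_rpow hq0]
        exact lintegral_sub_right_eq_self (fun x => ‖f x‖ₑ ^ q) y
    _ = _ := by simp

/-- The error is an average of the differences `f(x - y) - f(x)`, so only translations by `y` in the
kernel's ball matter. The set `S` permits a purely local use, where the differences are controlled
only near a point. -/
theorem eLpNorm_mollify_sub_le (hk : IsMollifier k c r) {q : ℝ} (hq : 1 ≤ q) {f : Rd d → E}
    (hf : LocallyIntegrable f) {ε : ℝ≥0∞} {S : Set (Rd d)}
    (hε : ∀ y : Rd d, ‖y - c‖ < r →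
      eLpNorm (fun x => f (x - y) - f x) (ENNReal.ofReal q) (volume.restrict S) ≤ ε) :
    eLpNorm (fun x => mollify k f x - f x) (ENNReal.ofReal q) (volume.restrict S) ≤ ε := by
  have := hk.isProbabilityMeasure
  have hq0 : 0 < q := by linarith
  have hm : AEMeasurable (Function.uncurry fun x y => ‖f (x - y) - f x‖ₑ)
      ((volume.restrict S).prod hk.measure) := by
    have h1 := ((hk.aemeasurable_translate hf.aestronglyMeasurable).sub
      hf.aestronglyMeasurable.comp_fst).enorm
    exact h1.mono_ac (Measure.AbsolutelyContinuous.prod Measure.restrict_le_self.absolutelyContinuous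
      Measure.AbsolutelyContinuous.rfl)
  refine eLpNorm_ofReal_le_of_rpow_le hq0 ?_
  calc ∫⁻ x in S, ‖mollify k f x - f x‖ₑ ^ q
      ≤ ∫⁻ x in S, (∫⁻ y, ‖f (x - y) - f x‖ₑ ∂hk.measure) ^ q :=
        lintegral_mono fun x => ENNReal.rpow_le_rpow (hk.enorm_mollify_sub_le hf x _) hq0.le
    _ ≤ ∫⁻ y, (∫⁻ x in S, ‖f (x - y) - f x‖ₑ ^ q) ∂hk.measure := lintegral_rpow_lintegral_le hq hm
    _ ≤ ∫⁻ _, ε ^ q ∂hk.measure := by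
        refine lintegral_mono_ae ?_
        filter_upwards [hk.ae_norm_sub_lt] with y hy
        rw [← eLpNorm_ofReal_rpow hq0]
        exact ENNReal.rpow_le_rpow (hε y hy) hq0.le
    _ = _ := by simp

end IsMollifier

theorem tendsto_eLpNorm_mollify_sub [NormedSpace ℝ E] [CompleteSpace E] {q : ℝ} (hq : 1 ≤ q) {f : Rd d → E}
    (hf : MemLp f (ENNReal.ofReal q) volume) {k : ℕ → Rd d → ℝ} {c : ℕ → Rd d} {r : ℕ → ℝ}
    (hk : ∀ n, IsMollifier (k n) (c n) (r n)) (hc : Tendsto c atTop (𝓝 0))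
    (hr : Tendsto r atTop (𝓝 0)) :
    Tendsto (fun n => eLpNorm (fun x => mollify (k n) f x - f x) (ENNReal.ofReal q) volume)
      atTop (𝓝 0) := by
  have hq1 : 1 ≤ ENNReal.ofReal q := by
    rw [← ENNReal.ofReal_one]; exact ENNReal.ofReal_le_ofReal hq
  rw [ENNReal.tendsto_atTop_zero]
  intro ε hε
  obtain ⟨δ, hδ, h⟩ := exists_eLpNorm_translate_sub_le hq hf hε
  have hlim : Tendsto (fun n => r n + ‖c n‖) atTop (𝓝 0) := by simpa using hr.add hc.norm
  obtain ⟨N, hN⟩ := eventually_atTop.1 (hlim.eventually_lt_const hδ)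
  refine ⟨N, fun n hn => ?_⟩
  rw [← Measure.restrict_univ (μ := volume)]
  refine (hk n).eLpNorm_mollify_sub_le hq (hf.locallyIntegrable hq1) fun y hy => ?_
  rw [Measure.restrict_univ]
  refine h y ?_
  have h1 := hN n hn
  have h2 := norm_add_le (y - c n) (c n)
  rw [sub_add_cancel] at h2
  linarith

namespace IsMollifier

variable {k : Rd d → ℝ} {c : Rd d} {r : ℝ}

theorem mollify_eq_convolution (f : Rd d → ℝ) :
    mollify k f = convolution f k (ContinuousLinearMap.mul ℝ ℝ) volume := by
  ext x
  simp only [mollify, convolution_def, ContinuousLinearMap.mul_apply', smul_eq_mul, mul_comm]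

theorem contDiff_mollify (hk : IsMollifier k c r) {f : Rd d → ℝ} (hf : LocallyIntegrable f) :
    ContDiff ℝ ∞ (mollify k f) := by
  rw [mollify_eq_convolution]
  exact hk.hasCompactSupport.contDiff_convolution_right _ hf hk.contDiff

theorem continuous_mollify [NormedSpace ℝ E] (hk : IsMollifier k c r)
    {f : Rd d → E} (hf : LocallyIntegrable f) : Continuous (mollify k f) := by
  have h := hk.hasCompactSupport.continuous_convolution_right
    (L := (ContinuousLinearMap.lsmul ℝ ℝ : ℝ →L[ℝ] E →L[ℝ] E).flip) hf hk.contDiff.continuous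
  exact h

theorem gradient_mollify_apply (hk : IsMollifier k c r) {f : Rd d → ℝ} (hf : LocallyIntegrable f)
    (x : Rd d) (i : Fin d) : gradient (mollify k f) x i = ∫ y, f y * gradient k (x - y) i := by
  have h1 : ContDiff ℝ 1 k := hk.contDiff.of_le (by simp)
  have h := hk.hasCompactSupport.hasFDerivAt_convolution_right (ContinuousLinearMap.mul ℝ ℝ) hf h1 x
  rw [← mollify_eq_convolution] at h
  rw [gradient_apply_eq_fderiv, h.fderiv, convolution_precompR_apply]
  · simp only [convolution_def, ContinuousLinearMap.mul_apply', gradient_apply_eq_fderiv]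
  · exact hf
  · exact hk.hasCompactSupport.fderiv ℝ
  · exact h1.continuous_fderiv one_ne_zero

/-- Mollification commutes with the distributional gradient wherever the kernel stays in `Ω`. -/
theorem gradient_mollify_indicator (hk : IsMollifier k c r) (hΩ : IsOpen Ω) {u : Rd d → ℝ}
    {G : Rd d → Rd d} (hu : IntegrableOn u Ω) (hG : IntegrableOn G Ω) (h : HasWeakGradient Ω u G)
    {x : Rd d} (hx : Metric.closedBall (x - c) r ⊆ Ω) :
    gradient (mollify k (Ω.indicator u)) x = mollify k (Ω.indicator G) x := by
  have hu' := (hu.integrable_indicator hΩ.measurableSet).locallyIntegrable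
  have hG' := (hG.integrable_indicator hΩ.measurableSet).locallyIntegrable
  -- The reflected kernel is itself a test function on `Ω`; the sign from reflection cancels the one
  -- in the definition of the distributional gradient.
  set η : Rd d → ℝ := fun y => k (x - y) with hη
  have hηs : Function.support η ⊆ Metric.closedBall (x - c) r := by
    intro y hy
    have := hk.norm_sub_lt _ hy
    rw [mem_closedBall_iff_norm, show y - (x - c) = -(x - y - c) by abel, norm_neg]
    exact this.le
  have hηt : IsTestFunction Ω η := ⟨hk.contDiff.comp (by fun_prop),
    HasCompactSupport.of_support_subset_isCompact (isCompact_closedBall _ _) hηs,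
    (closure_minimal hηs Metric.isClosed_closedBall).trans hx⟩
  have hgrad : ∀ y i, gradient η y i = - gradient k (x - y) i := by
    intro y i
    rw [gradient_apply_eq_fderiv, gradient_apply_eq_fderiv]
    have h1 : HasFDerivAt η ((fderiv ℝ k (x - y)).comp (-ContinuousLinearMap.id ℝ (Rd d))) y :=
      ((hk.contDiff.differentiable (by simp)) (x - y)).hasFDerivAt.comp y
        ((hasFDerivAt_id y).const_sub x)
    rw [h1.fderiv]
    simp
  ext i
  rw [hk.gradient_mollify_apply hu']
  have h1 := h.2.2 η hηt i
  simp only [hgrad, mul_neg, integral_neg, neg_inj] at h1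
  have e1 : ∫ y, Ω.indicator u y * gradient k (x - y) i = ∫ y in Ω, u y * gradient k (x - y) i := by
    rw [← integral_indicator hΩ.measurableSet]
    refine integral_congr_ae (Eventually.of_forall fun y => ?_)
    by_cases hy : y ∈ Ω <;> simp [hy]
  rw [e1, h1, mollify]
  have h2 := (PiLp.proj 2 (fun _ : Fin d => ℝ) i : Rd d →L[ℝ] ℝ).integral_comp_comm
    (hk.integrable_smul hG' x)
  simp only [PiLp.proj_apply] at h2
  rw [← h2, ← integral_indicator hΩ.measurableSet]
  refine integral_congr_ae (Eventually.of_forall fun y => ?_)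
  by_cases hy : y ∈ Ω <;> simp [hy, hη, mul_comm]

end IsMollifier

end ImageRestoring

/-! ### Density up to the boundary and extension of the Neumann condition -/

namespace ImageRestoring
open Filter Topology

variable {d : ℕ} {Ω : Set (Rd d)} {p : ℝ}

/-- Near any point of the closure, small translations in a fixed direction move the closure of `Ω`
into the interior. -/
theorem HasContinuousBoundary.exists_inward_translation (hΩ : HasContinuousBoundary Ω)
    (hΩo : IsOpen Ω) {x₀ : Rd d} (hx₀ : x₀ ∈ closure Ω) :
    ∃ r > 0, ∃ e : Rd d, ‖e‖ ≤ 1 ∧ ∃ t₀ > 0, ∀ t : ℝ, 0 < t → t ≤ t₀ →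
      ∃ ε > 0, ∀ x ∈ closure Ω ∩ Metric.ball x₀ r, Metric.closedBall (x + t • e) ε ⊆ Ω := by
  by_cases hx : x₀ ∈ Ω
  · obtain ⟨r, hr, hball⟩ := Metric.isOpen_iff.1 hΩo x₀ hx
    -- At an interior point no translation is needed, so the direction is zero.
    refine ⟨r / 2, by positivity, 0, by simp, 1, one_pos, fun t _ _ => ⟨r / 3, by positivity, ?_⟩⟩
    intro x hx y hy
    apply hball
    have h1 := hx.2
    simp only [smul_zero, add_zero, Metric.mem_closedBall, Metric.mem_ball] at hy h1 ⊢
    have := dist_triangle y x x₀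
    linarith
  obtain ⟨e, g, r, he, hg, hr, hiff⟩ := hΩ x₀ ⟨hx₀, by rwa [hΩo.interior_eq]⟩
  -- The height above the graph. Moving by `t e` leaves the orthogonal component unchanged and
  -- raises the height by exactly `t`. Near `x₀` the closure lies in `φ ≥ 0` and `Ω` is `φ > 0`.
  set φ : Rd d → ℝ := fun x => inner ℝ e x - g (x - inner ℝ e x • e) with hφ
  have hφc : Continuous φ := by fun_prop
  have hφe : ∀ x (t : ℝ), φ (x + t • e) = φ x + t := by
    intro x t
    have h1 : inner ℝ e (x + t • e) = inner ℝ e x + t := by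
      rw [inner_add_right, inner_smul_right, real_inner_self_eq_norm_sq, he]
      ring
    have h2 : x + t • e - (inner ℝ e x + t) • e = x - inner ℝ e x • e := by module
    simp only [hφ, h1, h2]
    ring
  have hφ0 : ∀ x ∈ closure Ω ∩ Metric.ball x₀ r, 0 ≤ φ x := by
    intro x hx
    have hx' : x ∈ closure (Metric.ball x₀ r ∩ Ω) :=
      Metric.isOpen_ball.inter_closure ⟨hx.2, hx.1⟩
    have hcl : closure (Metric.ball x₀ r ∩ Ω) ⊆ {y | 0 ≤ φ y} := by
      refine closure_minimal (fun y hy => ?_) (isClosed_le continuous_const hφc)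
      exact (sub_pos.2 ((hiff y hy.1).1 hy.2)).le
    exact hcl hx'
  refine ⟨r / 2, by positivity, e, he.le, r / 4, by positivity, fun t ht ht4 => ?_⟩
  have hK : IsCompact ((fun x => x + t • e) '' (closure Ω ∩ Metric.closedBall x₀ (r / 2))) :=
    ((isCompact_closedBall _ _).inter_left isClosed_closure).image (by fun_prop)
  have hKΩ : (fun x => x + t • e) '' (closure Ω ∩ Metric.closedBall x₀ (r / 2)) ⊆ Ω := by
    rintro _ ⟨x, hx, rfl⟩
    have hx2 := hx.2
    rw [Metric.mem_closedBall, dist_eq_norm] at hx2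
    have hmem : x + t • e ∈ Metric.ball x₀ r := by
      rw [Metric.mem_ball, dist_eq_norm, add_sub_right_comm]
      refine (norm_add_le _ _).trans_lt ?_
      rw [norm_smul, he, Real.norm_of_nonneg ht.le]
      linarith
    have h0 := hφ0 x ⟨hx.1, by rw [Metric.mem_ball, dist_eq_norm]; linarith⟩
    refine (hiff _ hmem).2 (sub_pos.1 ?_)
    change 0 < φ (x + t • e)
    rw [hφe]
    linarith
  -- Compactness of the translated piece makes the margin `ε` uniform in `x`.
  obtain ⟨ε, hε, hsub⟩ := hK.exists_cthickening_subset_open hΩo hKΩ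
  refine ⟨ε, hε, fun x hx => (Metric.closedBall_subset_cthickening ?_ ε).trans hsub⟩
  exact ⟨x, ⟨hx.1, Metric.ball_subset_closedBall hx.2⟩, rfl⟩

theorem mollify_eq_zero {E : Type*} [NormedAddCommGroup E] [NormedSpace ℝ E] {k : Rd d → ℝ}
    {c : Rd d} {r : ℝ} (hk : IsMollifier k c r) {f : Rd d → E} {x : Rd d}
    (h : ∀ y ∈ Metric.closedBall (x - c) r, f y = 0) : mollify k f x = 0 := by
  rw [mollify]
  refine integral_eq_zero_of_ae (Eventually.of_forall fun y => ?_)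
  by_cases hy : k (x - y) = 0
  · simp [hy]
  · have h1 := hk.norm_sub_lt _ hy
    beta_reduce
    rw [h y]
    · simp
    · rw [mem_closedBall_iff_norm, show y - (x - c) = -(x - y - c) by abel, norm_neg]
      exact h1.le

/-- The derivative of the kernel is only known to vanish off the closed support, which still lies in
the closed ball. -/
theorem gradient_mollify_eq_zero {k : Rd d → ℝ} {c : Rd d} {r : ℝ} (hk : IsMollifier k c r)
    {f : Rd d → ℝ} (hf : LocallyIntegrable f) {x : Rd d}
    (h : ∀ y ∈ Metric.closedBall (x - c) r, f y = 0) : gradient (mollify k f) x = 0 := by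
  ext i
  rw [hk.gradient_mollify_apply hf, PiLp.zero_apply]
  refine integral_eq_zero_of_ae (Eventually.of_forall fun y => ?_)
  by_cases hy : x - y ∈ tsupport k
  · have h1 := closure_minimal hk.support_subset Metric.isClosed_closedBall hy
    rw [mem_closedBall_iff_norm] at h1
    beta_reduce
    rw [h y]
    · simp
    · rwa [mem_closedBall_iff_norm, show y - (x - c) = -(x - y - c) by abel, norm_neg]
  · have h2 : fderiv ℝ k (x - y) = 0 := by
      by_contra hne
      exact hy (support_fderiv_subset ℝ hne)
    simp [gradient, h2]

theorem tendsto_eLpNorm_restrict_mollify_sub {E : Type*} [NormedAddCommGroup E] [NormedSpace ℝ E]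
    [CompleteSpace E] (hΩ : IsOpen Ω) {q : ℝ} (hq : 1 ≤ q) {f : Rd d → E}
    (hf : MemLp f (ENNReal.ofReal q) (volume.restrict Ω)) {k : ℕ → Rd d → ℝ} {c : ℕ → Rd d}
    {r : ℕ → ℝ} (hk : ∀ n, IsMollifier (k n) (c n) (r n)) (hc : Tendsto c atTop (𝓝 0))
    (hr : Tendsto r atTop (𝓝 0)) :
    Tendsto (fun n => eLpNorm (fun x => mollify (k n) (Ω.indicator f) x - f x) (ENNReal.ofReal q)
      (volume.restrict Ω)) atTop (𝓝 0) := by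
  have hf' := (memLp_indicator_iff_restrict hΩ.measurableSet).2 hf
  refine tendsto_of_tendsto_of_tendsto_of_le_of_le tendsto_const_nhds
    (tendsto_eLpNorm_mollify_sub hq hf' hk hc hr) (fun _ => zero_le) fun n => ?_
  refine le_trans (le_of_eq ?_) (eLpNorm_restrict_le _ _ _ Ω)
  refine eLpNorm_congr_ae ((ae_restrict_iff' hΩ.measurableSet).2 (Eventually.of_forall fun x hx => ?_))
  simp [hx]

/-- `v ∈ L²(Ω) ∩ W^{1,p}(Ω)` with distributional gradient `K`. -/
structure IsSobolevPair (Ω : Set (Rd d)) (p : ℝ) (v : Rd d → ℝ) (K : Rd d → Rd d) : Prop where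
  memLp_two : MemLp v 2 (volume.restrict Ω)
  memLp : MemLp v (ENNReal.ofReal p) (volume.restrict Ω)
  hasWeakGradient : HasWeakGradient Ω v K
  memLp_gradient : MemLp K (ENNReal.ofReal p) (volume.restrict Ω)

/-- Functions supported near a point of the closure are approximated by smooth functions. -/
theorem IsSobolevPair.exists_tendsto_of_support (hΩo : IsOpen Ω) (hΩb : Bornology.IsBounded Ω)
    (hp : 1 < p) {x₀ e : Rd d} {r t₀ : ℝ} (hr : 0 < r) (he : ‖e‖ ≤ 1) (ht₀ : 0 < t₀)
    (hin : ∀ t : ℝ, 0 < t → t ≤ t₀ → ∃ ε > 0, ∀ x ∈ closure Ω ∩ Metric.ball x₀ r,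
      Metric.closedBall (x + t • e) ε ⊆ Ω)
    {v : Rd d → ℝ} {K : Rd d → Rd d} (h : IsSobolevPair Ω p v K)
    (hsupp : ∀ y ∈ Ω, y ∉ Metric.ball x₀ (r / 2) → v y = 0 ∧ K y = 0) :
    ∃ ψ : ℕ → Rd d → ℝ, (∀ n, IsC1UpToBoundary Ω (ψ n)) ∧
      Tendsto (fun n => eLpNorm (fun x => ψ n x - v x) 2 (volume.restrict Ω)) atTop (𝓝 0) ∧
      Tendsto (fun n => eLpNorm (fun x => gradient (ψ n) x - K x) (ENNReal.ofReal p)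
        (volume.restrict Ω)) atTop (𝓝 0) := by
  -- The bound `t₀` keeps translations inward. The bound `r / 4` on both shift and radius ensures
  -- that averages taken from outside the ball of radius `r` never reach the ball of radius `r / 2`
  -- carrying `v`.
  set τ : ℝ := min t₀ (r / 4) with hτ
  have hτ0 : 0 < τ := lt_min ht₀ (by positivity)
  set t : ℕ → ℝ := fun n => τ * (1 / ((n : ℝ) + 1)) with ht
  have ht0 : ∀ n, 0 < t n := fun n => mul_pos hτ0 Nat.one_div_pos_of_nat
  have htτ : ∀ n, t n ≤ τ := fun n => by
    refine mul_le_of_le_one_right hτ0.le ?_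
    rw [div_le_one (by positivity)]
    linarith [Nat.cast_nonneg (α := ℝ) n]
  have htlim : Tendsto t atTop (𝓝 0) := by
    have := (tendsto_one_div_add_atTop_nhds_zero_nat (𝕜 := ℝ)).const_mul τ
    rwa [mul_zero] at this
  choose ε hε hεΩ using fun n => hin (t n) (ht0 n) ((htτ n).trans (min_le_left _ _))
  set ρ : ℕ → ℝ := fun n => min (ε n) (t n) with hρ
  have hρ0 : ∀ n, 0 < ρ n := fun n => lt_min (hε n) (ht0 n)
  -- With centre `-t e`, the mollification at `x` averages over a ball around `x + t e`, which lies
  -- in `Ω` even for `x` at the boundary.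
  choose k hk using fun n => exists_isMollifier (-(t n • e)) (hρ0 n)
  have hc : Tendsto (fun n => -(t n • e)) atTop (𝓝 0) := by
    simpa using (htlim.smul_const e).neg
  have hρlim : Tendsto ρ atTop (𝓝 0) :=
    squeeze_zero (fun n => (hρ0 n).le) (fun n => min_le_right _ _) htlim
  have hv1 := integrableOn_of_memLp hΩb (by norm_num) h.memLp_two
  have hK1 := integrableOn_of_memLp hΩb (one_le_ofReal hp) h.memLp_gradient
  have hv' := (hv1.integrable_indicator hΩo.measurableSet).locallyIntegrable
  refine ⟨fun n => mollify (k n) (Ω.indicator v), fun n =>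
    isC1UpToBoundary_of_contDiff ((hk n).contDiff_mollify hv'), ?_, ?_⟩
  · have h2 : ENNReal.ofReal 2 = 2 := by simp
    have hv2 : MemLp v (ENNReal.ofReal 2) (volume.restrict Ω) := by
      rw [h2]
      exact h.memLp_two
    have := tendsto_eLpNorm_restrict_mollify_sub hΩo one_le_two hv2 hk hc hρlim
    rwa [h2] at this
  · refine (tendsto_eLpNorm_restrict_mollify_sub hΩo hp.le h.memLp_gradient hk hc hρlim).congr
      fun n => eLpNorm_congr_ae ((ae_restrict_iff' hΩo.measurableSet).2
        (Eventually.of_forall fun x hx => ?_))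
    beta_reduce
    congr 1
    by_cases hxb : x ∈ Metric.ball x₀ r
    · refine ((hk n).gradient_mollify_indicator hΩo hv1 hK1 h.hasWeakGradient ?_).symm
      rw [sub_neg_eq_add]
      exact (Metric.closedBall_subset_closedBall (min_le_left _ _)).trans
        (hεΩ n x ⟨subset_closure hx, hxb⟩)
    · have hz : ∀ y ∈ Metric.closedBall (x - -(t n • e)) (ρ n), y ∈ Ω → v y = 0 ∧ K y = 0 := by
        intro y hy hyΩ
        refine hsupp y hyΩ fun hyb => hxb ?_
        rw [sub_neg_eq_add, mem_closedBall_iff_norm] at hy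
        rw [mem_ball_iff_norm] at hyb ⊢
        have e1 : x - x₀ = (y - x₀) - (y - (x + t n • e)) - t n • e := by abel
        have h1 : ‖t n • e‖ ≤ t n := by
          rw [norm_smul, Real.norm_of_nonneg (ht0 n).le]
          exact mul_le_of_le_one_right (ht0 n).le he
        have h2 : ρ n ≤ t n := min_le_right _ _
        have h3 : t n ≤ r / 4 := (htτ n).trans (min_le_right _ _)
        rw [e1]
        have h4 := norm_sub_le (y - x₀ - (y - (x + t n • e))) (t n • e)
        have h5 := norm_sub_le (y - x₀) (y - (x + t n • e))
        linarith
      rw [gradient_mollify_eq_zero (hk n) hv', mollify_eq_zero (hk n)]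
      · intro y hy
        by_cases hyΩ : y ∈ Ω
        · simp [hyΩ, (hz y hy hyΩ).2]
        · simp [hyΩ]
      · intro y hy
        by_cases hyΩ : y ∈ Ω
        · simp [hyΩ, (hz y hy hyΩ).1]
        · simp [hyΩ]

theorem memLp_smul_of_continuous {E : Type*} [NormedAddCommGroup E] [NormedSpace ℝ E]
    (hΩo : IsOpen Ω) (hΩb : Bornology.IsBounded Ω) {q : ℝ≥0∞} {θ : Rd d → ℝ} (hθ : Continuous θ)
    {v : Rd d → E} (hv : MemLp v q (volume.restrict Ω)) :
    MemLp (fun x => θ x • v x) q (volume.restrict Ω) := by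
  obtain ⟨C, -, hC⟩ := exists_bound_of_continuousOn_closure hΩb hθ.continuousOn
  refine hv.of_le_mul (c := C) (hθ.aestronglyMeasurable.smul hv.1)
    ((ae_restrict_iff' hΩo.measurableSet).2 (Eventually.of_forall fun x hx => ?_))
  rw [norm_smul]
  exact mul_le_mul_of_nonneg_right (hC x hx) (norm_nonneg _)

theorem memLp_smul_of_continuous' {E : Type*} [NormedAddCommGroup E] [NormedSpace ℝ E]
    [SecondCountableTopology E]
    (hΩo : IsOpen Ω) (hΩb : Bornology.IsBounded Ω) {q : ℝ≥0∞} {w : Rd d → E} (hw : Continuous w)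
    {v : Rd d → ℝ} (hv : MemLp v q (volume.restrict Ω)) :
    MemLp (fun x => v x • w x) q (volume.restrict Ω) := by
  obtain ⟨C, -, hC⟩ := exists_bound_of_continuousOn_closure hΩb hw.continuousOn
  refine hv.of_le_mul (c := C) (hv.1.smul hw.aestronglyMeasurable)
    ((ae_restrict_iff' hΩo.measurableSet).2 (Eventually.of_forall fun x hx => ?_))
  rw [norm_smul, mul_comm]
  exact mul_le_mul_of_nonneg_right (hC x hx) (norm_nonneg _)

theorem IsSobolevPair.smooth_mul (hΩo : IsOpen Ω) (hΩb : Bornology.IsBounded Ω) (hp : 1 < p)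
    {v θ : Rd d → ℝ} {K : Rd d → Rd d} (h : IsSobolevPair Ω p v K) (hθ : ContDiff ℝ ∞ θ) :
    IsSobolevPair Ω p (fun x => θ x * v x) (fun x => θ x • K x + v x • gradient θ x) := by
  have h1 := memLp_smul_of_continuous hΩo hΩb hθ.continuous h.memLp_two
  have h2 := memLp_smul_of_continuous hΩo hΩb hθ.continuous h.memLp
  have h3 := (memLp_smul_of_continuous hΩo hΩb hθ.continuous h.memLp_gradient).add
    (memLp_smul_of_continuous' hΩo hΩb (ContDiff.continuous_gradient hθ) h.memLp)
  exact ⟨h1, h2, h.hasWeakGradient.smooth_mul hθ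
    (integrableOn_of_memLp hΩb (by norm_num) h.memLp_two)
    (integrableOn_of_memLp hΩb (one_le_ofReal hp) h.memLp_gradient)
    (integrableOn_of_memLp hΩb (by norm_num) h1)
    (integrableOn_of_memLp hΩb (one_le_ofReal hp) h3), h3⟩

/-- The weak Neumann condition extends from `C¹(Ω̄)` to `L²(Ω) ∩ W^{1,p}(Ω)`. -/
theorem WeakNeumann.integral_inner_eq (hΩo : IsOpen Ω) (hΩb : Bornology.IsBounded Ω)
    (hΩ : HasContinuousBoundary Ω) (hp : 1 < p) {F : Rd d → Rd d} {f : Rd d → ℝ}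
    (hF : MemLp F (ENNReal.ofReal (p / (p - 1))) (volume.restrict Ω))
    (hf : MemLp f 2 (volume.restrict Ω)) (hN : WeakNeumann Ω F f)
    {v : Rd d → ℝ} {K : Rd d → Rd d} (h : IsSobolevPair Ω p v K) :
    ∫ x in Ω, inner ℝ (F x) (K x) = - ∫ x in Ω, f x * v x := by
  have hfin := isFiniteMeasure_restrict_of_isBounded hΩb
  have hconj := holderConjugate_ofReal hp
  have hiF : ∀ {v K}, IsSobolevPair Ω p v K →
      Integrable (fun x => inner ℝ (F x) (K x)) (volume.restrict Ω) := fun h =>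
    integrable_inner_of_memLp (a := ENNReal.ofReal (p / (p - 1))) (b := ENNReal.ofReal p) hF h.memLp_gradient
  have hif : ∀ {v K}, IsSobolevPair Ω p v K →
      Integrable (fun x => f x * v x) (volume.restrict Ω) := fun h =>
    hf.integrable_mul h.memLp_two
  -- Local case: approximate by smooth functions and pass to the limit on both sides. The radius
  -- exists for every `x₀`, with a dummy value off the closure, so that it can be chosen as a total
  -- function.
  have hloc : ∀ x₀ : Rd d, ∃ r > 0, x₀ ∈ closure Ω → ∀ v K, IsSobolevPair Ω p v K →
      (∀ y ∈ Ω, y ∉ Metric.ball x₀ (r / 2) → v y = 0 ∧ K y = 0) →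
      ∫ x in Ω, inner ℝ (F x) (K x) = - ∫ x in Ω, f x * v x := by
    intro x₀
    by_cases hx₀ : x₀ ∈ closure Ω
    swap
    · exact ⟨1, one_pos, fun hh => absurd hh hx₀⟩
    obtain ⟨r, hr, e, he, t₀, ht₀, hin⟩ := hΩ.exists_inward_translation hΩo hx₀
    refine ⟨r, hr, fun _ v K hvK hsupp => ?_⟩
    obtain ⟨ψ, hψ, h2, h3⟩ := hvK.exists_tendsto_of_support hΩo hΩb hp hr he ht₀ hin hsupp
    have l1 := tendsto_integral_inner_of_tendsto_eLpNorm (a := ENNReal.ofReal (p / (p - 1)))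
      (b := ENNReal.ofReal p) hF (fun n => (hψ n).memLp_gradient hΩo hΩb _) hvK.memLp_gradient h3
    have l2 := tendsto_integral_inner_of_tendsto_eLpNorm (a := 2) (b := 2) hf
      (fun n => (hψ n).memLp hΩo hΩb _) hvK.memLp_two h2
    have e1 : ∀ w : Rd d → ℝ, ∫ x in Ω, inner ℝ (f x) (w x) = ∫ x in Ω, f x * w x := fun w =>
      integral_congr_ae (Eventually.of_forall fun x => by simp [mul_comm])
    simp only [e1] at l2
    simp only [hN _ (hψ _)] at l1
    exact tendsto_nhds_unique l1 l2.neg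
  choose r hr hloc using hloc
  -- Induction on the number of balls in place of a partition of unity: each step splits `v = χ v +
  -- (1 - χ) v`, the first part local and the second vanishing on the ball removed.
  have hind : ∀ s : Finset (Rd d), (∀ x ∈ s, x ∈ closure Ω) → ∀ v K, IsSobolevPair Ω p v K →
      (∀ y ∈ Ω, y ∉ ⋃ x ∈ s, Metric.ball x (r x / 4) → v y = 0 ∧ K y = 0) →
      ∫ x in Ω, inner ℝ (F x) (K x) = - ∫ x in Ω, f x * v x := by
    intro s
    induction s using Finset.induction_on with
    | empty =>
      intro _ v K _ hz
      rw [setIntegral_eq_zero_of_forall_eq_zero, setIntegral_eq_zero_of_forall_eq_zero, neg_zero]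
      · intro y hy; rw [(hz y hy (by simp)).1, mul_zero]
      · intro y hy; rw [(hz y hy (by simp)).2, inner_zero_right]
    | insert x s hxs ih =>
      intro hcl v K hvK hz
      have hrx := hr x
      -- The cutoff is `1` on the ball of radius `r / 4` used in the covering, and its support stays
      -- within radius `3r / 8 < r / 2`, as the local case demands.
      let χ : ContDiffBump x := ⟨r x / 4, 3 * r x / 8, by positivity, by linarith⟩
      have hχ : ContDiff ℝ ∞ (χ : Rd d → ℝ) := χ.contDiff
      have hχ' : ContDiff ℝ ∞ (fun y => 1 - χ y) := contDiff_const.sub hχ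
      have hg' : ∀ y, gradient (fun y => 1 - χ y) y = - gradient (χ : Rd d → ℝ) y := by
        intro y
        simp only [gradient, fderiv_const_sub, map_neg]
      have p1 := hvK.smooth_mul hΩo hΩb hp hχ
      have p2 := hvK.smooth_mul hΩo hΩb hp hχ'
      have q1 := hloc x (hcl x (Finset.mem_insert_self x s)) _ _ p1 (by
        intro y hy hyb
        have hyt : y ∉ tsupport (χ : Rd d → ℝ) := by
          rw [χ.tsupport_eq]
          simp only [Metric.mem_closedBall, Metric.mem_ball, not_lt, not_le] at hyb ⊢
          change 3 * r x / 8 < dist y x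
          linarith
        have hg0 : gradient (χ : Rd d → ℝ) y = 0 := by
          have : fderiv ℝ (χ : Rd d → ℝ) y = 0 := by
            by_contra hne
            exact hyt (support_fderiv_subset ℝ hne)
          simp [gradient, this]
        simp [image_eq_zero_of_notMem_tsupport hyt, hg0])
      have q2 := ih (fun z hz => hcl z (Finset.mem_insert_of_mem hz)) _ _ p2 (by
        intro y hy hyb
        by_cases hyx : y ∈ Metric.ball x (r x / 4)
        · have h1 : (χ : Rd d → ℝ) =ᶠ[𝓝 y] 1 := χ.eventuallyEq_one_of_mem_ball hyx
          have hg0 : gradient (χ : Rd d → ℝ) y = 0 := by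
            have : fderiv ℝ (χ : Rd d → ℝ) y = 0 := by
              rw [h1.fderiv_eq]
              simp
            simp [gradient, this]
          rw [hg', hg0, h1.self_of_nhds]
          simp
        · have := hz y hy (by
            rw [Finset.set_biUnion_insert]
            exact fun hh => hh.elim hyx hyb)
          simp [this.1, this.2])
      have e1 : ∫ y in Ω, inner ℝ (F y) (K y) =
          (∫ y in Ω, inner ℝ (F y) (χ y • K y + v y • gradient (χ : Rd d → ℝ) y)) +
          ∫ y in Ω, inner ℝ (F y) ((1 - χ y) • K y + v y • gradient (fun y => 1 - χ y) y) := by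
        rw [← integral_add (hiF p1) (hiF p2)]
        refine integral_congr_ae (Eventually.of_forall fun y => ?_)
        beta_reduce
        rw [← inner_add_right, hg']
        congr 1
        module
      have e2 : ∫ y in Ω, f y * v y =
          (∫ y in Ω, f y * (χ y * v y)) + ∫ y in Ω, f y * ((1 - χ y) * v y) := by
        rw [← integral_add (hif p1) (hif p2)]
        refine integral_congr_ae (Eventually.of_forall fun y => ?_)
        ring
      rw [e1, e2, q1, q2]
      ring
  obtain ⟨s, hs, hcov⟩ := hΩb.isCompact_closure.elim_nhds_subcover (fun x => Metric.ball x (r x / 4))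
    fun x _ => Metric.ball_mem_nhds x (by have := hr x; positivity)
  exact hind s hs v K h fun y hy hyn => absurd (hcov (subset_closure hy)) hyn

end ImageRestoring

/-! ### Integrability of a function from that of its gradient -/

namespace ImageRestoring
open Filter Topology

variable {d : ℕ} {Ω : Set (Rd d)} {p : ℝ}

theorem eLpNorm_ofReal_lt_top_iff {α E : Type*} {m : MeasurableSpace α} [NormedAddCommGroup E]
    {μ : Measure α} {q : ℝ} (hq : 0 < q) {f : α → E} :
    eLpNorm f (ENNReal.ofReal q) μ < ⊤ ↔ ∫⁻ x, ‖f x‖ₑ ^ q ∂μ < ⊤ := by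
  rw [← eLpNorm_ofReal_rpow hq, ENNReal.rpow_lt_top_iff_of_pos hq]

theorem exists_closedBall_subset_of_segment (hΩ : IsOpen Ω) {x h : Rd d}
    (hseg : ∀ s ∈ Icc (0 : ℝ) 1, x + s • h ∈ Ω) :
    ∃ δ > 0, ∀ s ∈ Icc (0 : ℝ) 1, Metric.closedBall (x + s • h) δ ⊆ Ω := by
  have hK : IsCompact ((fun s : ℝ => x + s • h) '' Icc (0 : ℝ) 1) :=
    isCompact_Icc.image (Continuous.add continuous_const (continuous_id.smul continuous_const))
  obtain ⟨δ, hδ, hsub⟩ := hK.exists_cthickening_subset_open hΩ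
    (by rintro _ ⟨s, hs, rfl⟩; exact hseg s hs)
  refine ⟨δ, hδ, fun s hs => Subset.trans ?_ hsub⟩
  exact Metric.closedBall_subset_cthickening (mem_image_of_mem (fun s : ℝ => x + s • h) hs) δ

/-- Pointwise bound of a difference of the mollified function. -/
theorem enorm_mollify_sub_mollify_le (hΩ : IsOpen Ω) {u : Rd d → ℝ} {G : Rd d → Rd d}
    (hu : IntegrableOn u Ω) (hG : IntegrableOn G Ω) (hw : HasWeakGradient Ω u G)
    {k : Rd d → ℝ} {c : Rd d} {r : ℝ} (hk : IsMollifier k c r) {x h : Rd d}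
    (hx : ∀ s ∈ Icc (0 : ℝ) 1, Metric.closedBall (x + s • h - c) r ⊆ Ω) :
    ‖mollify k (Ω.indicator u) (x + h) - mollify k (Ω.indicator u) x‖ₑ ≤
      ‖h‖ₑ * ∫⁻ s in Ioc (0 : ℝ) 1, ‖mollify k (Ω.indicator G) (x + s • h)‖ₑ := by
  have hu' := (hu.integrable_indicator hΩ.measurableSet).locallyIntegrable
  have hG' := (hG.integrable_indicator hΩ.measurableSet).locallyIntegrable
  set U := mollify k (Ω.indicator u)
  set W := mollify k (Ω.indicator G)
  have hUd : Differentiable ℝ U := (hk.contDiff_mollify hu').differentiable (by simp)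
  have hWc : Continuous W := hk.continuous_mollify hG'
  have hder : ∀ s ∈ uIcc (0 : ℝ) 1,
      HasDerivAt (fun s : ℝ => U (x + s • h)) (inner ℝ h (W (x + s • h))) s := by
    intro s hs
    rw [uIcc_of_le zero_le_one] at hs
    have h1 : HasDerivAt (fun s : ℝ => x + s • h) h s := by
      simpa using ((hasDerivAt_id s).smul_const h).const_add x
    have h2 := (hUd (x + s • h)).hasFDerivAt.comp_hasDerivAt s h1
    rw [← inner_gradient_right, hk.gradient_mollify_indicator hΩ hu hG hw (hx s hs)] at h2
    exact h2
  have hcont : Continuous fun s : ℝ => inner ℝ h (W (x + s • h)) := by fun_prop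
  -- Fundamental theorem of calculus along the segment, where the gradient of the mollified function
  -- is the mollified gradient.
  have hftc := intervalIntegral.integral_eq_sub_of_hasDerivAt hder (hcont.intervalIntegrable 0 1)
  simp only [one_smul, zero_smul, add_zero] at hftc
  rw [← hftc, intervalIntegral.integral_of_le zero_le_one]
  refine (enorm_integral_le_lintegral_enorm _).trans ?_
  rw [← lintegral_const_mul' _ _ enorm_ne_top]
  refine lintegral_mono fun s => ?_
  rw [← ofReal_norm, ← ofReal_norm, ← ofReal_norm,
    ← ENNReal.ofReal_mul (norm_nonneg _)]
  exact ENNReal.ofReal_le_ofReal (norm_inner_le_norm h _)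

/-- Differences of a function are controlled in `L^p` by its distributional gradient. -/
theorem HasWeakGradient.lintegral_translate_sub_le (hΩ : IsOpen Ω) (hp : 1 ≤ p) {u : Rd d → ℝ}
    {G : Rd d → Rd d} (hu : IntegrableOn u Ω) (hG : IntegrableOn G Ω) (hw : HasWeakGradient Ω u G)
    {S : Set (Rd d)} (hS : MeasurableSet S) {h : Rd d}
    (hseg : ∀ x ∈ S, ∀ s ∈ Icc (0 : ℝ) 1, x + s • h ∈ Ω) :
    eLpNorm (fun x => Ω.indicator u (x + h) - Ω.indicator u x) (ENNReal.ofReal p)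
      (volume.restrict S) ≤ ‖h‖ₑ * eLpNorm G (ENNReal.ofReal p) (volume.restrict Ω) := by
  have hp0 : 0 < p := by linarith
  have hui := hu.integrable_indicator hΩ.measurableSet
  have hu' := hui.locallyIntegrable
  have hG' := (hG.integrable_indicator hΩ.measurableSet).locallyIntegrable
  set U := Ω.indicator u
  set W := Ω.indicator G
  have hr : ∀ n : ℕ, 0 < 1 / ((n : ℝ) + 1) := fun n => Nat.one_div_pos_of_nat
  choose k hk using fun n => exists_isMollifier (0 : Rd d) (hr n)
  have hlim := tendsto_eLpNorm_mollify_sub (q := 1) le_rfl (by simpa using memLp_one_iff_integrable.2 hui)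
    hk tendsto_const_nhds tendsto_one_div_add_atTop_nhds_zero_nat
  -- Initially `u` is only in `L¹`, so the mollified functions converge almost everywhere along a
  -- subsequence. The segment estimate holds from an index depending on `x`, and Fatou's lemma
  -- absorbs this dependence.
  obtain ⟨φ, hφ, hae⟩ := (tendstoInMeasure_of_tendsto_eLpNorm (by simp)
    (fun n => ((hk n).contDiff_mollify hu').continuous.aestronglyMeasurable)
    hui.aestronglyMeasurable hlim).exists_seq_tendsto_ae
  have hae' : ∀ᵐ x, Tendsto (fun i => mollify (k (φ i)) U (x + h)) atTop (𝓝 (U (x + h))) :=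
    (measurePreserving_add_right volume h).quasiMeasurePreserving.ae hae
  set A : ℕ → Rd d → ℝ≥0∞ := fun i x =>
    ‖h‖ₑ * ∫⁻ s in Ioc (0 : ℝ) 1, ‖mollify (k (φ i)) W (x + s • h)‖ₑ with hA
  have hWc : ∀ i, Continuous (mollify (k (φ i)) W) := fun i => (hk _).continuous_mollify hG'
  have hAm : ∀ i, Measurable fun x : Rd d => ∫⁻ s in Ioc (0 : ℝ) 1, ‖mollify (k (φ i)) W (x + s • h)‖ₑ := by
    intro i
    refine Measurable.lintegral_prod_right' (f := fun z : Rd d × ℝ => ‖mollify (k (φ i)) W (z.1 + z.2 • h)‖ₑ) ?_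
    exact (by have := hWc i; fun_prop : Continuous fun z : Rd d × ℝ => mollify (k (φ i)) W (z.1 + z.2 • h)).enorm.measurable
  have hprob : IsProbabilityMeasure (volume.restrict (Ioc (0 : ℝ) 1)) := ⟨by simp⟩
  have hAle : ∀ i, ∫⁻ x in S, A i x ^ p ≤ (‖h‖ₑ * eLpNorm G (ENNReal.ofReal p) (volume.restrict Ω)) ^ p := by
    intro i
    have e0 : eLpNorm G (ENNReal.ofReal p) (volume.restrict Ω) = eLpNorm W (ENNReal.ofReal p) volume :=
      (eLpNorm_indicator_eq_eLpNorm_restrict hΩ.measurableSet).symm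
    simp only [hA, ENNReal.mul_rpow_of_nonneg _ _ hp0.le]
    rw [lintegral_const_mul _ ((hAm i).pow_const p), e0]
    gcongr
    calc ∫⁻ x in S, (∫⁻ s in Ioc (0 : ℝ) 1, ‖mollify (k (φ i)) W (x + s • h)‖ₑ) ^ p
        ≤ ∫⁻ x, (∫⁻ s in Ioc (0 : ℝ) 1, ‖mollify (k (φ i)) W (x + s • h)‖ₑ) ^ p :=
          setLIntegral_le_lintegral _ _
      _ ≤ ∫⁻ s in Ioc (0 : ℝ) 1, (∫⁻ x, ‖mollify (k (φ i)) W (x + s • h)‖ₑ ^ p) := by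
          refine lintegral_rpow_lintegral_le (ν := volume.restrict (Ioc (0 : ℝ) 1)) hp ?_
          exact (by have := hWc i; fun_prop : Continuous fun z : Rd d × ℝ =>
            mollify (k (φ i)) W (z.1 + z.2 • h)).enorm.measurable.aemeasurable
      _ = ∫⁻ s in Ioc (0 : ℝ) 1, eLpNorm (mollify (k (φ i)) W) (ENNReal.ofReal p) volume ^ p := by
          refine lintegral_congr fun s => ?_
          rw [eLpNorm_ofReal_rpow hp0]
          exact lintegral_add_right_eq_self (fun x => ‖mollify (k (φ i)) W x‖ₑ ^ p) (s • h)
      _ = eLpNorm (mollify (k (φ i)) W) (ENNReal.ofReal p) volume ^ p := by simp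
      _ ≤ _ := ENNReal.rpow_le_rpow ((hk _).eLpNorm_mollify_le hp hG') hp0.le
  refine eLpNorm_ofReal_le_of_rpow_le hp0 ?_
  calc ∫⁻ x in S, ‖U (x + h) - U x‖ₑ ^ p ≤ ∫⁻ x in S, liminf (fun i => A i x ^ p) atTop := by
        refine lintegral_mono_ae ?_
        rw [ae_restrict_iff' hS]
        filter_upwards [hae, hae'] with x h1 h2 hxS
        have h3 : Tendsto (fun i => ‖mollify (k (φ i)) U (x + h) - mollify (k (φ i)) U x‖ₑ ^ p) atTop
            (𝓝 (‖U (x + h) - U x‖ₑ ^ p)) :=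
          ((h2.sub h1).enorm).ennrpow_const p
        rw [← h3.liminf_eq]
        refine liminf_le_liminf ?_
        obtain ⟨δ, hδ, hball⟩ := exists_closedBall_subset_of_segment hΩ (hseg x hxS)
        have h4 : Tendsto (fun i => 1 / ((φ i : ℝ) + 1)) atTop (𝓝 0) :=
          tendsto_one_div_add_atTop_nhds_zero_nat.comp hφ.tendsto_atTop
        filter_upwards [h4.eventually_lt_const hδ] with i hi
        refine ENNReal.rpow_le_rpow ?_ hp0.le
        refine enorm_mollify_sub_mollify_le hΩ hu hG hw (hk (φ i)) fun s hs => ?_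
        rw [sub_zero]
        exact (Metric.closedBall_subset_closedBall hi.le).trans (hball s hs)
    _ ≤ liminf (fun i => ∫⁻ x in S, A i x ^ p) atTop :=
        lintegral_liminf_le' fun i => (((hAm i).const_mul _).pow_const p).aemeasurable
    _ ≤ _ := liminf_le_of_frequently_le' (Eventually.of_forall hAle).frequently

theorem setLIntegral_rpow_lt_top_of_isCompact {f : Rd d → ℝ} {C : Set (Rd d)} (hC : IsCompact C)
    (h : ∀ x ∈ C, ∃ r > 0, ∫⁻ y in Ω ∩ Metric.ball x r, ‖f y‖ₑ ^ p < ⊤) :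
    ∫⁻ y in Ω ∩ C, ‖f y‖ₑ ^ p < ⊤ := by
  refine hC.induction_on (p := fun s => ∫⁻ y in Ω ∩ s, ‖f y‖ₑ ^ p < ⊤) (by simp) ?_ ?_ ?_
  · intro s t hst ht
    exact (lintegral_mono_set (inter_subset_inter_right Ω hst)).trans_lt ht
  · intro s t hs ht
    rw [inter_union_distrib_left]
    exact (lintegral_union_le _ _ _).trans_lt (ENNReal.add_lt_top.2 ⟨hs, ht⟩)
  · intro x hx
    obtain ⟨r, hr, hlt⟩ := h x hx
    exact ⟨Metric.ball x r, mem_nhdsWithin_of_mem_nhds (Metric.ball_mem_nhds x hr), hlt⟩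

/-- A function with distributional gradient in `L^p(Ω)` is locally in `L^p`. -/
theorem HasWeakGradient.lintegral_rpow_ball_lt_top (hΩ : IsOpen Ω) (hp : 1 ≤ p) {u : Rd d → ℝ}
    {G : Rd d → Rd d} (hu : IntegrableOn u Ω) (hG : IntegrableOn G Ω) (hw : HasWeakGradient Ω u G)
    (hGp : MemLp G (ENNReal.ofReal p) (volume.restrict Ω)) {x : Rd d} (hx : x ∈ Ω) :
    ∃ r > 0, ∫⁻ y in Ω ∩ Metric.ball x r, ‖Ω.indicator u y‖ₑ ^ p < ⊤ := by
  have hp0 : 0 < p := by linarith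
  have hui := hu.integrable_indicator hΩ.measurableSet
  have hu' := hui.locallyIntegrable
  set U := Ω.indicator u
  obtain ⟨R, hR, hball⟩ := Metric.isOpen_iff.1 hΩ x hx
  set r := R / 2
  have hr : 0 < r := by positivity
  refine ⟨r, hr, ?_⟩
  obtain ⟨k, hk⟩ := exists_isMollifier (0 : Rd d) hr
  -- Write `u` as its mollification, which is continuous, minus the error. The error is in `L^p` on
  -- the ball by the translation estimate: with `r = R / 2` the segments stay in `Ω`.
  have hdiff := hk.eLpNorm_mollify_sub_le hp hu' (S := Metric.ball x r)
    (ε := ENNReal.ofReal r * eLpNorm G (ENNReal.ofReal p) (volume.restrict Ω)) (by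
      intro y hy
      rw [sub_zero] at hy
      have h1 := hw.lintegral_translate_sub_le hΩ hp hu hG
        (Metric.isOpen_ball (x := x) (ε := r)).measurableSet (h := -y) (by
          intro z hz s hs
          apply hball
          rw [mem_ball_iff_norm] at hz ⊢
          rw [add_sub_right_comm]
          refine (norm_add_le _ _).trans_lt ?_
          rw [norm_smul, norm_neg, Real.norm_of_nonneg hs.1]
          have : s * ‖y‖ ≤ ‖y‖ := mul_le_of_le_one_left (norm_nonneg _) hs.2
          have : R = r + r := by ring
          linarith)
      simp only [← sub_eq_add_neg] at h1
      refine h1.trans ?_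
      gcongr
      rw [enorm_neg, ← ofReal_norm]
      exact ENNReal.ofReal_le_ofReal hy.le)
  have hlt : eLpNorm (fun y => mollify k U y - U y) (ENNReal.ofReal p)
      (volume.restrict (Metric.ball x r)) < ⊤ :=
    hdiff.trans_lt (ENNReal.mul_lt_top ENNReal.ofReal_lt_top hGp.2)
  have hcm := (hk.contDiff_mollify hu').continuous
  have h1 : MemLp (fun y => mollify k U y - U y) (ENNReal.ofReal p)
      (volume.restrict (Metric.ball x r)) :=
    ⟨(hcm.aestronglyMeasurable.sub hui.aestronglyMeasurable).restrict, hlt⟩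
  have h2 : MemLp (mollify k U) (ENNReal.ofReal p) (volume.restrict (Metric.ball x r)) :=
    memLp_of_continuousOn_closure Metric.isOpen_ball Metric.isBounded_ball hcm.continuousOn
      (fun _ _ => rfl) _
  have h3 := (eLpNorm_ofReal_lt_top_iff hp0).1 (h2.sub h1).2
  refine (lintegral_mono_set inter_subset_right).trans_lt ?_
  simpa using h3

/-- On a bounded open set with continuous boundary, an integrable function with distributional
gradient in `L^p` is itself in `L^p`. -/
theorem HasWeakGradient.memLp (hΩo : IsOpen Ω) (hΩb : Bornology.IsBounded Ω)
    (hΩ : HasContinuousBoundary Ω) (hp : 1 ≤ p) {u : Rd d → ℝ} {G : Rd d → Rd d}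
    (hu : IntegrableOn u Ω) (hw : HasWeakGradient Ω u G)
    (hGp : MemLp G (ENNReal.ofReal p) (volume.restrict Ω)) :
    MemLp u (ENNReal.ofReal p) (volume.restrict Ω) := by
  have hp0 : 0 < p := by linarith
  have hG : IntegrableOn G Ω := integrableOn_of_memLp hΩb (by
    rw [← ENNReal.ofReal_one]; exact ENNReal.ofReal_le_ofReal hp) hGp
  have hui := hu.integrable_indicator hΩo.measurableSet
  set U := Ω.indicator u with hU
  have hcomp : ∀ C, IsCompact C → C ⊆ Ω → ∫⁻ y in C, ‖U y‖ₑ ^ p < ⊤ := by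
    intro C hC hCΩ
    have := setLIntegral_rpow_lt_top_of_isCompact (Ω := Ω) (p := p) (f := U) hC fun x hx =>
      hw.lintegral_rpow_ball_lt_top hΩo hp hu hG hGp (hCΩ hx)
    rwa [inter_eq_self_of_subset_right hCΩ] at this
  have hloc : ∀ x ∈ closure Ω, ∃ r > 0, ∫⁻ y in Ω ∩ Metric.ball x r, ‖U y‖ₑ ^ p < ⊤ := by
    intro x₀ hx₀
    obtain ⟨r, hr, e, he, t₀, ht₀, hin⟩ := hΩ.exists_inward_translation hΩo hx₀
    refine ⟨r, hr, ?_⟩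
    set S := Ω ∩ Metric.ball x₀ r with hS
    have hSm : MeasurableSet S := (hΩo.inter Metric.isOpen_ball).measurableSet
    have hScl : ∀ x ∈ S, x ∈ closure Ω ∩ Metric.ball x₀ r := fun x hx => ⟨subset_closure hx.1, hx.2⟩
    -- The difference between `u` and its inward translate is in `L^p` near the boundary point. The
    -- translate takes its values in a compact subset of `Ω`, where the interior estimate applies.
    have hd := hw.lintegral_translate_sub_le hΩo hp hu hG hSm (h := t₀ • e) (by
      intro x hx s hs
      -- The inward property is available only for positive translations, so the endpoint `s = 0` is
      -- separate.
      rcases hs.1.eq_or_lt with h0 | h0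
      · rw [← h0, zero_smul, add_zero]
        exact hx.1
      · obtain ⟨ε, hε, hsub⟩ := hin (s * t₀) (mul_pos h0 ht₀) (mul_le_of_le_one_left ht₀.le hs.2)
        rw [smul_smul]
        exact hsub x (hScl x hx) (Metric.mem_closedBall_self hε.le))
    have hd' : eLpNorm (fun x => U (x + t₀ • e) - U x) (ENNReal.ofReal p) (volume.restrict S) < ⊤ :=
      hd.trans_lt (ENNReal.mul_lt_top enorm_lt_top hGp.2)
    obtain ⟨ε, hε, hsub⟩ := hin t₀ ht₀ le_rfl
    set C := closure ((fun x => x + t₀ • e) '' S) with hC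
    have hCc : IsCompact C := by
      refine Bornology.IsBounded.isCompact_closure (hΩb.subset ?_)
      rintro _ ⟨x, hx, rfl⟩
      exact hsub x (hScl x hx) (Metric.mem_closedBall_self hε.le)
    have hCΩ : C ⊆ Ω := by
      intro y hy
      obtain ⟨_, ⟨x, hx, rfl⟩, hdist⟩ := Metric.mem_closure_iff.1 hy ε hε
      exact hsub x (hScl x hx) hdist.le
    have htr : ∫⁻ x in S, ‖U (x + t₀ • e)‖ₑ ^ p < ⊤ := by
      refine lt_of_le_of_lt ?_ (hcomp C hCc hCΩ)
      rw [← lintegral_indicator hSm, ← lintegral_indicator isClosed_closure.measurableSet,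
        ← lintegral_add_right_eq_self (fun y => C.indicator (fun y => ‖U y‖ₑ ^ p) y) (t₀ • e)]
      refine lintegral_mono fun x => ?_
      by_cases hx : x ∈ S
      · have hxC : x + t₀ • e ∈ C := subset_closure ⟨x, hx, rfl⟩
        simp [hx, hxC]
      · simp [hx]
    have hUm := hui.aestronglyMeasurable
    have hUm' : AEStronglyMeasurable (fun x => U (x + t₀ • e)) volume :=
      hUm.comp_measurePreserving (measurePreserving_add_right volume _)
    have m1 : MemLp (fun x => U (x + t₀ • e)) (ENNReal.ofReal p) (volume.restrict S) :=
      ⟨hUm'.restrict, (eLpNorm_ofReal_lt_top_iff hp0).2 htr⟩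
    have m2 : MemLp (fun x => U (x + t₀ • e) - U x) (ENNReal.ofReal p) (volume.restrict S) :=
      ⟨(hUm'.sub hUm).restrict, hd'⟩
    have h3 := (eLpNorm_ofReal_lt_top_iff hp0).1 (m1.sub m2).2
    simpa using h3
  have hfin := setLIntegral_rpow_lt_top_of_isCompact (Ω := Ω) (p := p) (f := U)
    hΩb.isCompact_closure hloc
  rw [inter_eq_self_of_subset_left subset_closure, ← eLpNorm_ofReal_lt_top_iff hp0] at hfin
  have hUp : MemLp U (ENNReal.ofReal p) (volume.restrict Ω) := ⟨hui.aestronglyMeasurable.restrict, hfin⟩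
  refine hUp.ae_eq ((ae_restrict_iff' hΩo.measurableSet).2 (Eventually.of_forall fun x hx => ?_))
  simp [hU, hx]

end ImageRestoring

/-! ### Identification of the operator with the subdifferential -/

namespace ImageRestoring
open Filter Topology

variable {d : ℕ} {Ω : Set (Rd d)} {j : Rd d → ℝ} {p : ℝ}

theorem inner_eq_integral_mul (f g : L2 Ω) : (inner ℝ f g : ℝ) = ∫ x in Ω, f x * g x := by
  rw [MeasureTheory.L2.inner_def]
  exact integral_congr_ae (Eventually.of_forall fun x => by simp [mul_comm])

theorem IsSobolevPair.of_hasWeakGradient {v : L2 Ω} {K : Rd d → Rd d}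
    (hv : MemLp v (ENNReal.ofReal p) (volume.restrict Ω)) (hK : HasWeakGradient Ω v K)
    (hKp : MemLp K (ENNReal.ofReal p) (volume.restrict Ω)) : IsSobolevPair Ω p v K :=
  ⟨Lp.memLp v, hv, hK, hKp⟩

/-- Integrate `β(∇u) · (∇v - ∇u) ≤ j(∇v) - j(∇u)` and evaluate the left side by the extended Neumann
identity with test function `v - u`. -/
theorem divOperator_subset_subdifferential (hΩo : IsOpen Ω) (hΩb : Bornology.IsBounded Ω)
    (hΩ : HasContinuousBoundary Ω) (hp : 1 < p) (hjc : ConvexOn ℝ univ j)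
    (hjd : Differentiable ℝ j) {Cβ : ℝ} (hβ : ∀ r, ‖gradient j r‖ ≤ Cβ * (1 + ‖r‖) ^ (p - 1))
    (hint : ∀ G : Rd d → Rd d, MemLp G (ENNReal.ofReal p) (volume.restrict Ω) →
      Integrable (fun x => j (G x)) (volume.restrict Ω)) (u : L2 Ω) :
    divOperator Ω p (gradient j) u ⊆ subdifferential (energy Ω p j) u := by
  have hfin := isFiniteMeasure_restrict_of_isBounded hΩb
  have hconj := holderConjugate_ofReal hp
  rintro _ ⟨hu, f, -, hN, rfl⟩ v
  obtain ⟨hG, hGp⟩ := hu.weakGradient_spec hΩo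
  set G := weakGradient Ω u
  by_cases hv : energy Ω p j v = ⊤
  · rw [hv]; simp
  obtain ⟨K, hvp, hK, hKp, hKi, hvK⟩ := energy_ne_top hΩo hv
  have hF := memLp_gradient_comp hp hβ hGp
  have hKG : MemLp (fun x => (1 : ℝ) • K x + (-1 : ℝ) • G x) (ENNReal.ofReal p) (volume.restrict Ω) :=
    (hKp.const_smul (1 : ℝ)).add (hGp.const_smul (-1 : ℝ))
  have key := hN.integral_inner_eq hΩo hΩb hΩ hp hF (Lp.memLp f)
    (IsSobolevPair.of_hasWeakGradient (memLp_smul_add_smul hvp hu.1 1 (-1))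
      (hK.smul_add_smul hΩb hp hG hKp hGp 1 (-1)) hKG)
  rw [← inner_eq_integral_mul] at key
  rw [energy_eq_integral hΩo hu.1 hG hGp (hint _ hGp), hvK]
  norm_cast
  have hle : ∫ x in Ω, inner ℝ (gradient j (G x)) ((1 : ℝ) • K x + (-1 : ℝ) • G x)
      ≤ ∫ x in Ω, (j (K x) - j (G x)) := by
    refine integral_mono (integrable_inner_of_memLp (a := ENNReal.ofReal (p / (p - 1)))
      (b := ENNReal.ofReal p) hF hKG) (hKi.sub (hint _ hGp)) fun x => ?_
    have := ConvexOn.inner_gradient_le hjc hjd (G x) ((1 : ℝ) • K x + (-1 : ℝ) • G x)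
    rwa [show G x + ((1 : ℝ) • K x + (-1 : ℝ) • G x) = K x by module] at this
  rw [key, integral_sub hKi (hint _ hGp)] at hle
  have e : inner ℝ (-f) (u - v) = (inner ℝ f ((1 : ℝ) • v + (-1 : ℝ) • u) : ℝ) := by
    rw [inner_neg_left, ← inner_neg_right]
    congr 1
    module
  rw [e]
  linarith

/-- The subgradient inequality along `u + t z`, divided by `t`. By convexity the difference
quotients of `j` for `0 < t < 1` lie between the derivative and the quotient at `t = 1`, both
integrable, so dominated convergence gives the limit. -/
theorem inner_le_of_mem_subdifferential (hΩo : IsOpen Ω) (hΩb : Bornology.IsBounded Ω)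
    (hp : 1 < p) (hjc : ConvexOn ℝ univ j)
    (hjd : Differentiable ℝ j) {Cβ : ℝ} (hβ : ∀ r, ‖gradient j r‖ ≤ Cβ * (1 + ‖r‖) ^ (p - 1))
    (hint : ∀ G : Rd d → Rd d, MemLp G (ENNReal.ofReal p) (volume.restrict Ω) →
      Integrable (fun x => j (G x)) (volume.restrict Ω)) {u y : L2 Ω}
    (hy : y ∈ subdifferential (energy Ω p j) u) {G : Rd d → Rd d}
    (hu : IsSobolevPair Ω p u G) {z : L2 Ω} {D : Rd d → Rd d} (hz : IsSobolevPair Ω p z D) :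
    inner ℝ y z ≤ ∫ x in Ω, inner ℝ (gradient j (G x)) (D x) := by
  have hfin := isFiniteMeasure_restrict_of_isBounded hΩb
  have hconj := holderConjugate_ofReal hp
  have hF := memLp_gradient_comp hp hβ hu.memLp_gradient
  have hGi := hint _ hu.memLp_gradient
  have hsum : ∀ t : ℝ, MemLp (fun x => G x + t • D x) (ENNReal.ofReal p) (volume.restrict Ω) :=
    fun t => hu.memLp_gradient.add (hz.memLp_gradient.const_smul t)
  have hFD := integrable_inner_of_memLp (a := ENNReal.ofReal (p / (p - 1)))
      (b := ENNReal.ofReal p) hF hz.memLp_gradient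
  have hsl : ∀ t : ℝ, Integrable (fun x => t⁻¹ * (j (G x + t • D x) - j (G x))) (volume.restrict Ω) :=
    fun t => ((hint _ (hsum t)).sub hGi).const_mul _
  have hlim : Tendsto (fun t : ℝ => ∫ x in Ω, t⁻¹ * (j (G x + t • D x) - j (G x))) (𝓝[>] 0)
      (𝓝 (∫ x in Ω, inner ℝ (gradient j (G x)) (D x))) := by
    refine tendsto_integral_filter_of_dominated_convergence
      (fun x => ‖j (G x + (1 : ℝ) • D x) - j (G x)‖ + ‖inner ℝ (gradient j (G x)) (D x)‖)
      (Eventually.of_forall fun t => (hsl t).aestronglyMeasurable) ?_ ?_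
      (Eventually.of_forall fun x => tendsto_slope_inner_gradient hjd _ _)
    · filter_upwards [Ioo_mem_nhdsGT (zero_lt_one (α := ℝ))] with t ht
      refine Eventually.of_forall fun x => ?_
      have h1 := ConvexOn.slope_le hjc (G x) (D x) ht.1 ht.2.le
      have h2 := ConvexOn.inner_gradient_le_slope hjc hjd (G x) (D x) ht.1
      rw [one_smul]
      simp only [Real.norm_eq_abs]
      rw [abs_le]
      constructor
      · linarith [neg_abs_le (inner ℝ (gradient j (G x)) (D x)), abs_nonneg (j (G x + D x) - j (G x))]
      · linarith [le_abs_self (j (G x + D x) - j (G x)), abs_nonneg (inner ℝ (gradient j (G x)) (D x))]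
    · exact ((hint _ (hsum 1)).sub hGi).norm.add hFD.norm
  refine ge_of_tendsto hlim ?_
  filter_upwards [self_mem_nhdsWithin] with t ht
  have ht0 : 0 < t := ht
  have h := hy ((1 : ℝ) • u + t • z)
  have hw := hu.hasWeakGradient.smul_add_smul hΩb hp hz.hasWeakGradient hu.memLp_gradient
    hz.memLp_gradient 1 t
  simp only [one_smul] at hw h
  have hm : MemLp (u + t • z : L2 Ω) (ENNReal.ofReal p) (volume.restrict Ω) := by
    simpa only [one_smul] using memLp_smul_add_smul hu.memLp hz.memLp 1 t
  rw [energy_eq_integral hΩo hu.memLp hu.hasWeakGradient hu.memLp_gradient hGi,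
    energy_eq_integral hΩo hm hw (hsum t) (hint _ (hsum t))] at h
  norm_cast at h
  rw [show u - (u + t • z) = -(t • z) by abel, inner_neg_right, inner_smul_right] at h
  rw [integral_const_mul, integral_sub (hint _ (hsum t)) hGi, le_inv_mul_iff₀ ht0]
  linarith

/-- Functions in `C¹(Ω̄)` are admissible directions because they and their gradients are bounded on
`Ω`. The one-sided inequality for `ψ` and `-ψ` is the Neumann identity, and its restriction to test
functions is the divergence equation. -/
theorem subdifferential_subset_divOperator (hΩo : IsOpen Ω) (hΩb : Bornology.IsBounded Ω)
    (hp : 1 < p) (hjc : ConvexOn ℝ univ j)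
    (hjd : Differentiable ℝ j) {Cβ : ℝ} (hβ : ∀ r, ‖gradient j r‖ ≤ Cβ * (1 + ‖r‖) ^ (p - 1))
    (hint : ∀ G : Rd d → Rd d, MemLp G (ENNReal.ofReal p) (volume.restrict Ω) →
      Integrable (fun x => j (G x)) (volume.restrict Ω)) (u : L2 Ω) :
    subdifferential (energy Ω p j) u ⊆ divOperator Ω p (gradient j) u := by
  have hfin := isFiniteMeasure_restrict_of_isBounded hΩb
  intro y hy
  have hne : energy Ω p j u ≠ ⊤ := by
    intro h
    have h1 := hy 0
    have h0 := energy_zero_ne_top (p := p) (j := j) hΩo hΩb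
    obtain ⟨K, -, -, -, -, hK⟩ := energy_ne_top hΩo h0
    rw [h, top_le_iff, hK] at h1
    exact EReal.coe_ne_top _ h1
  have hu : MemW1p Ω p u := by
    obtain ⟨G, h1, h2, h3, -⟩ := energy_ne_top hΩo hne
    exact ⟨h1, G, h2, h3⟩
  obtain ⟨hG, hGp⟩ := hu.weakGradient_spec hΩo
  have hpair : IsSobolevPair Ω p u (weakGradient Ω u) := ⟨Lp.memLp u, hu.1, hG, hGp⟩
  have hN : WeakNeumann Ω (fun x => gradient j (weakGradient Ω u x)) (-y : L2 Ω) := by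
    intro ψ hψ
    have hψ2 := hψ.memLp hΩo hΩb 2
    set z : L2 Ω := hψ2.toLp ψ
    have hzae : ψ =ᵐ[volume.restrict Ω] z := hψ2.coeFn_toLp.symm
    have hzp : MemLp z (ENNReal.ofReal p) (volume.restrict Ω) := (hψ.memLp hΩo hΩb _).ae_eq hzae
    have hDp := hψ.memLp_gradient hΩo hΩb (ENNReal.ofReal p)
    have hzD : HasWeakGradient Ω z (gradient ψ) := (hψ.hasWeakGradient hΩo hΩb).congr
      (L2.integrableOn hΩb z) (integrableOn_of_memLp hΩb (one_le_ofReal hp) hDp) hzae EventuallyEq.rfl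
    have hz : IsSobolevPair Ω p z (gradient ψ) := ⟨Lp.memLp z, hzp, hzD, hDp⟩
    -- The direction `-z`, written as a combination so that the linearity lemmas for gradients
    -- apply.
    have hz' : IsSobolevPair Ω p ((0 : ℝ) • z + (-1 : ℝ) • z : L2 Ω)
        (fun x => (0 : ℝ) • gradient ψ x + (-1 : ℝ) • gradient ψ x) :=
      IsSobolevPair.of_hasWeakGradient (memLp_smul_add_smul hzp hzp _ _)
        (hzD.smul_add_smul hΩb hp hzD hDp hDp _ _)
        ((hDp.const_smul (0 : ℝ)).add (hDp.const_smul (-1 : ℝ)))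
    have h1 := inner_le_of_mem_subdifferential hΩo hΩb hp hjc hjd hβ hint hy hpair hz
    have h2 := inner_le_of_mem_subdifferential hΩo hΩb hp hjc hjd hβ hint hy hpair hz'
    simp only [zero_smul, zero_add, neg_smul, one_smul, inner_neg_right, integral_neg] at h2
    have e : ∫ x in Ω, (-y : L2 Ω) x * ψ x = - inner ℝ y z := by
      rw [← inner_neg_left, inner_eq_integral_mul]
      refine integral_congr_ae ?_
      filter_upwards [hzae] with x hx
      rw [hx]
    rw [e, neg_neg]
    linarith
  refine ⟨hu, -y, ⟨?_, (L2.integrableOn hΩb _).locallyIntegrableOn, fun ψ hψ =>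
    hN ψ (isC1UpToBoundary_of_contDiff hψ.1)⟩, hN, (neg_neg y).symm⟩
  refine (integrableOn_of_memLp hΩb ?_ (memLp_gradient_comp hp hβ hGp)).locallyIntegrableOn
  exact one_le_ofReal ((one_lt_div (by linarith)).2 (by linarith))

end ImageRestoring
-- Maximal monotonicity
theorem theorem3p1 (d : ℕ) (Ω : Set (ImageRestoring.Rd d)) (hΩo : IsOpen Ω)
    (hΩb : Bornology.IsBounded Ω) (hΩ : ImageRestoring.HasContinuousBoundary Ω)
    (p : ℝ) (hp : 1 < p)
    (j : ImageRestoring.Rd d → ℝ) (hjc : ConvexOn ℝ Set.univ j) (hjd : Differentiable ℝ j)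
    (ω₁ ω₂ C₁ C₂ : ℝ) (hω₁ : 0 < ω₁) (hω₂ : 0 < ω₂)
    (hj : ∀ r : ImageRestoring.Rd d,
      ω₁ * ‖r‖ ^ p + C₁ ≤ j r ∧ j r ≤ ω₂ * ‖r‖ ^ p + C₂) :
    ImageRestoring.IsMaximalMonotone (ImageRestoring.divOperator Ω p (gradient j)) ∧
    ImageRestoring.IsConvexFunctional (ImageRestoring.energy Ω p j) ∧
    LowerSemicontinuous (ImageRestoring.energy Ω p j) ∧
    ∀ u : ImageRestoring.L2 Ω, ImageRestoring.divOperator Ω p (gradient j) u =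
      ImageRestoring.subdifferential (ImageRestoring.energy Ω p j) u := by
  have hfin := ImageRestoring.isFiniteMeasure_restrict_of_isBounded hΩb
  obtain ⟨Cβ, -, hβ⟩ := ImageRestoring.exists_norm_gradient_le hjc hjd hp hω₁ hω₂ hj
  have hint : ∀ G : ImageRestoring.Rd d → ImageRestoring.Rd d,
      MemLp G (ENNReal.ofReal p) (volume.restrict Ω) →
      Integrable (fun x => j (G x)) (volume.restrict Ω) :=
    fun G hG => ImageRestoring.integrable_comp_of_growth hjd.continuous hp hj hG
  have hconv := ImageRestoring.isConvexFunctional_energy hΩo hΩb hp hjc hint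
  have hlsc := ImageRestoring.lowerSemicontinuous_energy hΩo hΩb hp hjc hjd.continuous hω₁ hj
    fun u G hG hGp => hG.memLp hΩo hΩb hΩ hp.le (ImageRestoring.L2.integrableOn hΩb u) hGp
  have heq : ∀ u : ImageRestoring.L2 Ω, ImageRestoring.divOperator Ω p (gradient j) u =
      ImageRestoring.subdifferential (ImageRestoring.energy Ω p j) u := fun u =>
    Subset.antisymm
      (ImageRestoring.divOperator_subset_subdifferential hΩo hΩb hΩ hp hjc hjd hβ hint u)
      (ImageRestoring.subdifferential_subset_divOperator hΩo hΩb hp hjc hjd hβ hint u)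
  have hzero := ImageRestoring.energy_zero_ne_top (p := p) (j := j) hΩo hΩb
  -- On a bounded domain this bounds the energy below, as the minimization behind the resolvent
  -- equation requires.
  have hlow : ∀ r, C₁ ≤ j r := fun r => by
    have h1 := (hj r).1
    have h2 : 0 ≤ ω₁ * ‖r‖ ^ p := by positivity
    linarith
  refine ⟨?_, hconv, hlsc, heq⟩
  rw [show ImageRestoring.divOperator Ω p (gradient j) =
    ImageRestoring.subdifferential (ImageRestoring.energy Ω p j) from funext heq]
  exact ⟨ImageRestoring.isMonotoneOperator_subdifferential ImageRestoring.energy_ne_bot hzero,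
    ImageRestoring.exists_add_eq_of_convex_of_lowerSemicontinuous hconv hlsc
      (ImageRestoring.le_energy hΩb hlow) hzero⟩
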